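/- There exists a universal constant $c > 0$ such that the following holds. Let $D \subseteq \mathbb{R}^d$ ($d$ arbitrary) and let $f$ be a Gaussian process on $D$ (not necessarily centred, possibly degenerate) with continuous sample paths, with covariance kernel $K(x,y) = \mathrm{Cov}[f(x), f(y)]$. Call a measurable set $A$ of continuous functions $g : D \to \mathbb{R}$ (measurable with respect to the $\sigma$-algebra generated by the evaluations $g \mapsto g(x)$, $x \in D$) an event; call it *increasing* if $g \in A$ implies $g + v \in A$ for every continuous $v : D \to \mathbb{R}$ with $v \ge 0$, and *supported on* $D' \subseteq D$ if, for every continuous $v : D \to \mathbb{R}$ with $v|_{D'} = 0$, one has $g \in A \iff g + v \in A$. For a real number $s$, write $f+s$ for the process $x \mapsto f(x)+s$. Let $D_1, D_2 \subseteq D$ be compact, and put $\|K_{D_1,D_2}\|_\infty = \sup_{x \in D_1, y \in D_2} |K(x,y)|$ (with value $0$ if $D_1$ or $D_2$ is empty); this quantity is finite. Then for all increasing events $A_1$ supported on $D_1$ and $A_2$ supported on $D_2$, and all $\varepsilon > 0$, $$ \mathbb{P}[f \in A_1 \cap A_2] - \mathbb{P}[f + \varepsilon \in A_1]\,\mathbb{P}[f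 + \varepsilon \in A_2] \le \frac{c\, \|K_{D_1,D_2}\|_\infty}{\varepsilon^2}, \qquad (1) $$ and $$ \mathbb{P}[f - \varepsilon \in A_1]\,\mathbb{P}[f - \varepsilon \in A_2] - \mathbb{P}[f \in A_1 \cap A_2] \le \frac{c\, \|K_{D_1,D_2}\|_\infty}{\varepsilon^2}. \qquad (2) $$ If moreover $K(x,y) \ge 0$ for all $x \in D_1$, $y \in D_2$, then (1) holds with $c = 1$ and (2) holds with $c = 0$. -/

import Mathlib

open MeasureTheory ProbabilityTheory

namespace SprinkledDecoupling

/-- The σ-algebra on the path space `C(T, ℝ)` generated by the evaluations `g ↦ g x`, `x : T`. -/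
@[reducible]
def pathSigmaAlgebra (T : Type*) [TopologicalSpace T] : MeasurableSpace C(T, ℝ) :=
  MeasurableSpace.comap (fun (g : C(T, ℝ)) (x : T) => g x) MeasurableSpace.pi

/-- An event of the path space: a set that is measurable for the evaluation σ-algebra. -/
def IsPathEvent {T : Type*} [TopologicalSpace T] (A : Set C(T, ℝ)) : Prop :=
  MeasurableSet[pathSigmaAlgebra T] A

/-- `A` is increasing: adding a nonnegative continuous function does not leave `A`. -/
def IsIncreasing {T : Type*} [TopologicalSpace T] (A : Set C(T, ℝ)) : Prop :=
  ∀ v : C(T, ℝ), (∀ x, 0 ≤ v x) → ∀ g : C(T, ℝ), g ∈ A → g + v ∈ A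

/-- `A` is supported on `S`: adding a continuous function that vanishes on `S` does not change
whether a path lies in `A`. -/
def IsSupportedOn {T : Type*} [TopologicalSpace T] (A : Set C(T, ℝ)) (S : Set T) : Prop :=
  ∀ v : C(T, ℝ), (∀ x ∈ S, v x = 0) → ∀ g : C(T, ℝ), g ∈ A ↔ g + v ∈ A

/-- The covariance kernel `K(x, y) = Cov[f(x), f(y)]` of a random continuous function. -/
noncomputable def covKernel {T Ω : Type*} [TopologicalSpace T] [MeasurableSpace Ω]
    (P : Measure Ω) (f : Ω → C(T, ℝ)) (x y : T) : ℝ :=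
  cov[fun ω => f ω x, fun ω => f ω y; P]

/-- The supremum norm of the kernel `K` restricted to `S₁ × S₂`
(equal to `0` when `S₁ × S₂` is empty). -/
noncomputable def kernelSupNorm {T : Type*} (K : T → T → ℝ) (S₁ S₂ : Set T) : ℝ :=
  ⨆ p : S₁ × S₂, |K p.1 p.2|

/-- The probability `P[f + s ∈ A]`, where the real number `s` is added as a constant function. -/
noncomputable def shiftProb {T Ω : Type*} [TopologicalSpace T] [MeasurableSpace Ω]
    (P : Measure Ω) (f : Ω → C(T, ℝ)) (s : ℝ) (A : Set C(T, ℝ)) : ℝ :=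
  P.real {ω | f ω + ContinuousMap.const T s ∈ A}

end SprinkledDecoupling

/-!
The constant `c = 1` works in both inequalities.

The indicator of an increasing event `A` supported on a compact set is replaced by its sprinkled
version `Φ = sprinkle ε A`, for which `1_A(g) ≤ Φ g ≤ 1_A(g + ε)`. The functional `Φ` is increasing
and grows at rate at most `ε⁻¹` when a constant is added (`isSprinklableOn_sprinkle`), so that its
derivative in direction `v` can be thought of as the integral of `v` against a positive measure of
mass at most `ε⁻¹`. It is therefore enough to show that the covariance of two such functionals of
a Gaussian process lies between `ε⁻²` times a nonpositive lower bound and `ε⁻²` times a nonnegative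
upper bound for the covariance kernel on the product of the supports
(`covariance_mem_Icc_of_isSprinklableOn`). For a nonnegative kernel the lower bound is `0`, which
is the vanishing constant in the second inequality.

Interpolating paths between finitely many nodes of the compact sets reduces this to Gaussian
vectors (`IsSprinklableOn.exists_tendsto_interpolate`), and convolution with a bump function to
functions with a uniform quadratic Taylor remainder
(`IsSprinklable.exists_hasQuadraticExpansion`). For these, the usual interpolation formula for
Gaussian covariances is replaced by a scaling argument
(`covariance_mem_Icc_of_hasQuadraticExpansion`). If `(X, Y)` is a centred Gaussian vector, then
at a small scale `η` the covariance of `F (η X)` and `H (η Y)` is that of the linear parts, of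
order `η ^ 2`, up to an error `O(η ^ 3)` (`exists_abs_covariance_sub_le`). Since `√2 η (X, Y)` has
the law of the sum of two independent copies of `η (X, Y)`, the law of total covariance shows that
passing from scale `η` to scale `√2 η` at most doubles the bounds together with their error
(`covariance_bounds_sqrt_two_mul`). Going from scale `2 ^ (-n / 2)` to scale `1` multiplies
the error by `2 ^ n`, and `2 ^ n * 2 ^ (-3 n / 2)` tends to `0`.

Measurability of the events themselves is never needed: the sprinkled functionals of the process
are almost everywhere measurable as limits of continuous functions of finitely many values.
-/

namespace SprinkledDecoupling

/-! ### Covariance inequalities -/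

/-- The Cauchy–Schwarz inequality for covariances. -/
lemma abs_covariance_le_mul {Ω : Type*} [MeasurableSpace Ω] {P : Measure Ω} [IsProbabilityMeasure P]
    {U V : Ω → ℝ} (hU : MemLp U 2 P) (hV : MemLp V 2 P) {a b : ℝ} (ha : 0 ≤ a) (hb : 0 ≤ b)
    (hUa : Var[U; P] ≤ a ^ 2) (hVb : Var[V; P] ≤ b ^ 2) : |cov[U, V; P]| ≤ a * b := by
  have h (t : ℝ) : 0 ≤ Var[U; P] * (t * t) + 2 * cov[U, V; P] * t + Var[V; P] := by
    have h1 := variance_add (hU.const_smul t) hV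
    rw [covariance_smul_left, variance_smul] at h1
    have h2 := variance_nonneg (t • U + V) P
    rw [h1] at h2
    linarith
  have hd := discrim_le_zero h
  rw [discrim] at hd
  refine abs_le_of_sq_le_sq ?_ (by positivity)
  have : Var[U; P] * Var[V; P] ≤ a ^ 2 * b ^ 2 :=
    mul_le_mul hUa hVb (variance_nonneg _ _) (by positivity)
  nlinarith

lemma variance_le_of_abs_le_norm_pow {Ω E : Type*} [MeasurableSpace Ω] {P : Measure Ω}
    [IsProbabilityMeasure P] [NormedAddCommGroup E] {Z : Ω → E} {U : Ω → ℝ} (n : ℕ)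
    (hU : AEStronglyMeasurable U P)
    (hZ : Integrable (fun ω => ‖Z ω‖ ^ (2 * n)) P) {c : ℝ}
    (h : ∀ ω, |U ω| ≤ c * ‖Z ω‖ ^ n) :
    MemLp U 2 P ∧ Var[U; P] ≤ (c * √(∫ ω, ‖Z ω‖ ^ (2 * n) ∂P)) ^ 2 := by
  have hsq (ω : Ω) : U ω ^ 2 ≤ c ^ 2 * ‖Z ω‖ ^ (2 * n) := by
    calc U ω ^ 2 = |U ω| ^ 2 := (sq_abs _).symm
      _ ≤ (c * ‖Z ω‖ ^ n) ^ 2 := by gcongr; exact h ω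
      _ = _ := by ring
  have hint : Integrable (fun ω => U ω ^ 2) P := by
    refine (hZ.const_mul (c ^ 2)).mono' (hU.pow 2) (.of_forall fun ω => ?_)
    rw [Real.norm_eq_abs, abs_of_nonneg (sq_nonneg _)]
    exact hsq ω
  refine ⟨(memLp_two_iff_integrable_sq hU).2 hint, ?_⟩
  refine (variance_le_expectation_sq hU).trans ?_
  rw [mul_pow, Real.sq_sqrt (integral_nonneg fun ω => by positivity), ← integral_const_mul]
  exact integral_mono hint (hZ.const_mul _) hsq

/-! ### Functions with a quadratic Taylor remainder -/

/-- `F` is a bounded continuous function on `E` whose increments are approximated by linear forms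
`ℓ x ∈ S`, depending continuously on the base point `x`, up to a quadratic error with constant `M`
that is uniform in the base point. -/
structure HasQuadraticExpansion {E : Type*} [NormedAddCommGroup E] [NormedSpace ℝ E]
    (S : Set (StrongDual ℝ E)) (M : ℝ) (F : E → ℝ) (ℓ : E → StrongDual ℝ E) : Prop where
  continuous : Continuous F
  continuous_deriv : Continuous ℓ
  abs_le_one : ∀ x, |F x| ≤ 1
  deriv_mem : ∀ x, ℓ x ∈ S
  taylor : ∀ x h, |F (x + h) - F x - ℓ x h| ≤ M * ‖h‖ ^ 2

namespace HasQuadraticExpansion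

variable {E : Type*} [NormedAddCommGroup E] [NormedSpace ℝ E]
  {S : Set (StrongDual ℝ E)} {M : ℝ} {F : E → ℝ} {ℓ : E → StrongDual ℝ E}

lemma translate (hF : HasQuadraticExpansion S M F ℓ) (u : E) :
    HasQuadraticExpansion S M (fun x => F (u + x)) (fun x => ℓ (u + x)) where
  continuous := hF.continuous.comp (by fun_prop)
  continuous_deriv := hF.continuous_deriv.comp (by fun_prop)
  abs_le_one x := hF.abs_le_one _
  deriv_mem x := hF.deriv_mem _
  taylor x h := by
    rw [← add_assoc]
    exact hF.taylor _ _

lemma integrable_comp [MeasurableSpace E] [BorelSpace E] {Ω : Type*} [MeasurableSpace Ω]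
    {P : Measure Ω} [IsProbabilityMeasure P] (hF : HasQuadraticExpansion S M F ℓ) {U : Ω → E}
    (hU : AEMeasurable U P) : Integrable (fun ω => F (U ω)) P :=
  .of_bound (hF.continuous.measurable.comp_aemeasurable hU).aestronglyMeasurable 1
    (.of_forall fun _ => hF.abs_le_one _)

lemma memLp_two_comp [MeasurableSpace E] [BorelSpace E] {Ω : Type*} [MeasurableSpace Ω]
    {P : Measure Ω} [IsProbabilityMeasure P] (hF : HasQuadraticExpansion S M F ℓ) {U : Ω → E}
    (hU : AEMeasurable U P) : MemLp (fun ω => F (U ω)) 2 P :=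
  .of_bound (hF.continuous.measurable.comp_aemeasurable hU).aestronglyMeasurable 1
    (.of_forall fun _ => hF.abs_le_one _)

/-- The class is stable under averaging over random translations: this is what makes it suitable
for an induction that adds independent increments. -/
lemma average [MeasurableSpace E] [BorelSpace E] [SecondCountableTopology E]
    {Ω : Type*} [MeasurableSpace Ω]
    {P : Measure Ω} [IsProbabilityMeasure P] (hF : HasQuadraticExpansion S M F ℓ) {U : Ω → E}
    (hU : AEMeasurable U P) (hSc : Convex ℝ S) (hS : IsClosed S) {R : ℝ} (hR : ∀ a ∈ S, ‖a‖ ≤ R) :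
    HasQuadraticExpansion S M (fun x => ∫ ω, F (x + U ω) ∂P) (fun x => ∫ ω, ℓ (x + U ω) ∂P) := by
  have hmF (x : E) : AEStronglyMeasurable (fun ω => F (x + U ω)) P :=
    (hF.continuous.measurable.comp_aemeasurable (hU.const_add x)).aestronglyMeasurable
  have hmℓ (x : E) : AEStronglyMeasurable (fun ω => ℓ (x + U ω)) P :=
    hF.continuous_deriv.stronglyMeasurable.aestronglyMeasurable.comp_aemeasurable (hU.const_add x)
  have hiF (x : E) : Integrable (fun ω => F (x + U ω)) P := hF.integrable_comp (hU.const_add x)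
  have hiℓ (x : E) : Integrable (fun ω => ℓ (x + U ω)) P :=
    .of_bound (hmℓ x) R (.of_forall fun ω => hR _ (hF.deriv_mem _))
  refine ⟨?_, ?_, fun x => ?_, fun x => ?_, fun x h => ?_⟩
  · exact continuous_of_dominated hmF (fun x => .of_forall fun ω => hF.abs_le_one _)
      (integrable_const (1 : ℝ)) (.of_forall fun ω => hF.continuous.comp (by fun_prop))
  · exact continuous_of_dominated hmℓ (fun x => .of_forall fun ω => hR _ (hF.deriv_mem _))
      (integrable_const R) (.of_forall fun ω => hF.continuous_deriv.comp (by fun_prop))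
  · have := norm_integral_le_of_norm_le_const (μ := P) (f := fun ω => F (x + U ω)) (C := 1)
      (.of_forall fun ω => hF.abs_le_one _)
    simpa using this
  · exact hSc.integral_mem hS (.of_forall fun ω => hF.deriv_mem _) (hiℓ x)
  · have hd : Integrable (fun ω => F (x + h + U ω) - F (x + U ω)) P := (hiF _).sub (hiF _)
    rw [ContinuousLinearMap.integral_apply (hiℓ x), ← integral_sub (hiF _) (hiF _),
      ← integral_sub hd ((hiℓ x).apply_continuousLinearMap h)]
    have := norm_integral_le_of_norm_le_const (μ := P)
      (f := fun ω => F (x + h + U ω) - F (x + U ω) - ℓ (x + U ω) h) (C := M * ‖h‖ ^ 2)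
      (.of_forall fun ω => by
        rw [add_right_comm]
        exact hF.taylor _ _)
    simpa using this

end HasQuadraticExpansion

/-! ### The covariance bound for a centred Gaussian measure -/

section Gaussian

variable {E₁ E₂ : Type*} [NormedAddCommGroup E₁] [NormedSpace ℝ E₁] [MeasurableSpace E₁]
  [BorelSpace E₁] [SecondCountableTopology E₁]
  [NormedAddCommGroup E₂] [NormedSpace ℝ E₂] [MeasurableSpace E₂]
  [BorelSpace E₂] [SecondCountableTopology E₂]

/-- For small `η` the covariance of `F (η X)` and `H (η Y)` is that of their linear parts, up to an
error of order `η ^ 3` that is uniform over the class of functions. -/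
lemma exists_abs_covariance_sub_le (μ : Measure (E₁ × E₂)) [IsProbabilityMeasure μ]
    (h2 : Integrable (fun z => ‖z‖ ^ 2) μ) (h4 : Integrable (fun z => ‖z‖ ^ 4) μ)
    {S₁ : Set (StrongDual ℝ E₁)} {S₂ : Set (StrongDual ℝ E₂)} {R M₁ M₂ : ℝ}
    (hR : 0 ≤ R) (hM₁ : 0 ≤ M₁) (hM₂ : 0 ≤ M₂)
    (hR₁ : ∀ a ∈ S₁, ‖a‖ ≤ R) (hR₂ : ∀ b ∈ S₂, ‖b‖ ≤ R) :
    ∃ C, 0 ≤ C ∧ ∀ F ℓ H k, HasQuadraticExpansion S₁ M₁ F ℓ → HasQuadraticExpansion S₂ M₂ H k →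
      ∀ η : ℝ, 0 ≤ η → η ≤ 1 →
      |cov[fun z => F (η • z.1), fun z => H (η • z.2); μ]
        - η ^ 2 * cov[fun z => ℓ 0 z.1, fun z => k 0 z.2; μ]| ≤ C * η ^ 3 := by
  set N₂ := √(∫ z, ‖z‖ ^ 2 ∂μ)
  set N₄ := √(∫ z, ‖z‖ ^ 4 ∂μ)
  have hN₂ : 0 ≤ N₂ := Real.sqrt_nonneg _
  have hN₄ : 0 ≤ N₄ := Real.sqrt_nonneg _
  refine ⟨R * N₂ * M₂ * N₄ + M₁ * N₄ * R * N₂ + M₁ * N₄ * M₂ * N₄, by positivity, ?_⟩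
  intro F ℓ H k hF hH η hη0 hη1
  set r : E₁ × E₂ → ℝ := fun z => F (η • z.1) - F 0 - ℓ 0 (η • z.1) with hr
  set s : E₁ × E₂ → ℝ := fun z => H (η • z.2) - H 0 - k 0 (η • z.2) with hs
  have hcF := hF.continuous
  have hcH := hH.continuous
  have hrc : Continuous r := by fun_prop
  have hsc : Continuous s := by fun_prop
  have hr' (z : E₁ × E₂) : |r z| ≤ M₁ * η ^ 2 * ‖z‖ ^ 2 := by
    have h := hF.taylor 0 (η • z.1)
    rw [zero_add, norm_smul, Real.norm_eq_abs, abs_of_nonneg hη0] at h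
    refine h.trans ?_
    rw [mul_pow, mul_assoc]
    gcongr
    exact norm_fst_le z
  have hs' (z : E₁ × E₂) : |s z| ≤ M₂ * η ^ 2 * ‖z‖ ^ 2 := by
    have h := hH.taylor 0 (η • z.2)
    rw [zero_add, norm_smul, Real.norm_eq_abs, abs_of_nonneg hη0] at h
    refine h.trans ?_
    rw [mul_pow, mul_assoc]
    gcongr
    exact norm_snd_le z
  have ha' (z : E₁ × E₂) : |ℓ 0 z.1| ≤ R * ‖z‖ ^ 1 := by
    rw [pow_one]
    exact ((ℓ 0).le_opNorm z.1).trans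
      (mul_le_mul (hR₁ _ (hF.deriv_mem 0)) (norm_fst_le z) (norm_nonneg _) hR)
  have hb' (z : E₁ × E₂) : |k 0 z.2| ≤ R * ‖z‖ ^ 1 := by
    rw [pow_one]
    exact ((k 0).le_opNorm z.2).trans
      (mul_le_mul (hR₂ _ (hH.deriv_mem 0)) (norm_snd_le z) (norm_nonneg _) hR)
  obtain ⟨hrL, hrV⟩ := variance_le_of_abs_le_norm_pow (P := μ) 2
    hrc.aestronglyMeasurable h4 hr'
  obtain ⟨hsL, hsV⟩ := variance_le_of_abs_le_norm_pow (P := μ) 2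
    hsc.aestronglyMeasurable h4 hs'
  obtain ⟨haL, haV⟩ := variance_le_of_abs_le_norm_pow (P := μ) (U := fun z => ℓ 0 z.1) 1
    (by fun_prop) h2 ha'
  obtain ⟨hbL, hbV⟩ := variance_le_of_abs_le_norm_pow (P := μ) (U := fun z => k 0 z.2) 1
    (by fun_prop) h2 hb'
  have eF : (fun z : E₁ × E₂ => F (η • z.1))
      = fun z => (η • (fun z : E₁ × E₂ => ℓ 0 z.1) + r) z + F 0 := by
    funext z
    simp [hr]
  have eH : (fun z : E₁ × E₂ => H (η • z.2))
      = fun z => (η • (fun z : E₁ × E₂ => k 0 z.2) + s) z + H 0 := by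
    funext z
    simp [hs]
  have hc : cov[fun z => F (η • z.1), fun z => H (η • z.2); μ]
        - η ^ 2 * cov[fun z => ℓ 0 z.1, fun z => k 0 z.2; μ]
      = η * cov[fun z => ℓ 0 z.1, s; μ] + η * cov[r, fun z => k 0 z.2; μ] + cov[r, s; μ] := by
    rw [eF, eH, covariance_add_const_left
        (((haL.const_smul η).add hrL).integrable (by norm_num)),
      covariance_add_const_right (((hbL.const_smul η).add hsL).integrable (by norm_num)),
      covariance_add_left (haL.const_smul η) hrL ((hbL.const_smul η).add hsL),
      covariance_add_right (haL.const_smul η) (hbL.const_smul η) hsL,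
      covariance_add_right hrL (hbL.const_smul η) hsL,
      covariance_smul_left, covariance_smul_left, covariance_smul_right, covariance_smul_right]
    ring
  have c1 := abs_covariance_le_mul haL hsL (by positivity) (by positivity) haV hsV
  have c2 := abs_covariance_le_mul hrL hbL (by positivity) (by positivity) hrV hbV
  have c3 := abs_covariance_le_mul hrL hsL (by positivity) (by positivity) hrV hsV
  rw [hc]
  have hη4 : η ^ 4 ≤ η ^ 3 := pow_le_pow_of_le_one hη0 hη1 (by norm_num)
  calc _ ≤ |η * cov[fun z => ℓ 0 z.1, s; μ]| + |η * cov[r, fun z => k 0 z.2; μ]|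
        + |cov[r, s; μ]| := abs_add_three _ _ _
    _ ≤ η * (R * N₂ * (M₂ * η ^ 2 * N₄)) + η * (M₁ * η ^ 2 * N₄ * (R * N₂))
        + M₁ * η ^ 2 * N₄ * (M₂ * η ^ 2 * N₄) := by
      rw [abs_mul, abs_mul, abs_of_nonneg hη0]
      gcongr
    _ = (R * N₂ * M₂ * N₄ + M₁ * N₄ * R * N₂) * η ^ 3 + M₁ * N₄ * M₂ * N₄ * η ^ 4 := by ring
    _ ≤ (R * N₂ * M₂ * N₄ + M₁ * N₄ * R * N₂) * η ^ 3 + M₁ * N₄ * M₂ * N₄ * η ^ 3 := by gcongr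
    _ = _ := by ring

end Gaussian

/-- The law of total covariance on a product space, for bounded functions. -/
lemma covariance_prod_eq_add {α β : Type*} [MeasurableSpace α] [MeasurableSpace β]
    {μ : Measure α} {ν : Measure β} [IsProbabilityMeasure μ] [IsProbabilityMeasure ν]
    {f g : α × β → ℝ} (hf : Measurable f) (hg : Measurable g)
    (hf1 : ∀ p, |f p| ≤ 1) (hg1 : ∀ p, |g p| ≤ 1) :
    cov[f, g; μ.prod ν] = ∫ x, cov[fun y => f (x, y), fun y => g (x, y); ν] ∂μ
      + cov[fun x => ∫ y, f (x, y) ∂ν, fun x => ∫ y, g (x, y) ∂ν; μ] := by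
  have hfg1 (p : α × β) : |f p * g p| ≤ 1 := by
    rw [abs_mul]
    exact mul_le_one₀ (hf1 p) (abs_nonneg _) (hg1 p)
  have hIf : StronglyMeasurable fun x => ∫ y, f (x, y) ∂ν :=
    hf.stronglyMeasurable.integral_prod_right'
  have hIg : StronglyMeasurable fun x => ∫ y, g (x, y) ∂ν :=
    hg.stronglyMeasurable.integral_prod_right'
  have bound (u : α × β → ℝ) (hu : ∀ p, |u p| ≤ 1) (x : α) : ‖∫ y, u (x, y) ∂ν‖ ≤ 1 := by
    have := norm_integral_le_of_norm_le_const (μ := ν) (f := fun y => u (x, y)) (C := 1)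
      (.of_forall fun y => hu _)
    simpa using this
  have hLf : MemLp (fun x => ∫ y, f (x, y) ∂ν) 2 μ :=
    .of_bound hIf.aestronglyMeasurable 1 (.of_forall (bound f hf1))
  have hLg : MemLp (fun x => ∫ y, g (x, y) ∂ν) 2 μ :=
    .of_bound hIg.aestronglyMeasurable 1 (.of_forall (bound g hg1))
  have hif : Integrable f (μ.prod ν) :=
    .of_bound hf.aestronglyMeasurable 1 (.of_forall hf1)
  have hig : Integrable g (μ.prod ν) :=
    .of_bound hg.aestronglyMeasurable 1 (.of_forall hg1)
  have hifg : Integrable (fun p => f p * g p) (μ.prod ν) :=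
    .of_bound (hf.mul hg).aestronglyMeasurable 1 (.of_forall hfg1)
  have hx (x : α) : cov[fun y => f (x, y), fun y => g (x, y); ν]
      = ∫ y, f (x, y) * g (x, y) ∂ν - (∫ y, f (x, y) ∂ν) * ∫ y, g (x, y) ∂ν := by
    refine covariance_eq_sub ?_ ?_
    · exact .of_bound (hf.comp measurable_prodMk_left).aestronglyMeasurable 1
        (.of_forall fun y => hf1 _)
    · exact .of_bound (hg.comp measurable_prodMk_left).aestronglyMeasurable 1
        (.of_forall fun y => hg1 _)
  simp_rw [hx]
  rw [covariance_eq_sub (.of_bound hf.aestronglyMeasurable 1 (.of_forall hf1))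
    (.of_bound hg.aestronglyMeasurable 1 (.of_forall hg1)), covariance_eq_sub hLf hLg,
    integral_prod f hif, integral_prod g hig, integral_prod (f * g) hifg]
  simp only [Pi.mul_apply]
  have hsub : ∫ x, (∫ y, f (x, y) * g (x, y) ∂ν - (∫ y, f (x, y) ∂ν) * ∫ y, g (x, y) ∂ν) ∂μ
      = ∫ x, ∫ y, f (x, y) * g (x, y) ∂ν ∂μ
        - ∫ x, (∫ y, f (x, y) ∂ν) * ∫ y, g (x, y) ∂ν ∂μ :=
    integral_sub hifg.integral_prod_left (hLf.integrable_mul hLg)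
  rw [hsub]
  ring

section Gaussian

variable {E₁ E₂ : Type*} [NormedAddCommGroup E₁] [NormedSpace ℝ E₁] [MeasurableSpace E₁]
  [BorelSpace E₁] [SecondCountableTopology E₁]
  [NormedAddCommGroup E₂] [NormedSpace ℝ E₂] [MeasurableSpace E₂]
  [BorelSpace E₂] [SecondCountableTopology E₂]

/-- Rotation invariance turns the covariance at scale `√2 * η` into one for a sum of two
independent vectors at scale `η`. -/
lemma covariance_sqrt_two_mul {μ : Measure (E₁ × E₂)} [IsProbabilityMeasure μ]
    (hμ : (μ.prod μ).map (ContinuousLinearMap.rotation (Real.pi / 4)) = μ.prod μ)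
    {F : E₁ → ℝ} {H : E₂ → ℝ} (hF : Continuous F) (hH : Continuous H) (η : ℝ) :
    cov[fun z => F ((√2 * η) • z.1), fun z => H ((√2 * η) • z.2); μ]
      = cov[fun p => F (η • p.1.1 + η • p.2.1), fun p => H (η • p.1.2 + η • p.2.2);
          μ.prod μ] := by
  have hfst : μ = (μ.prod μ).map
      (fun p => (ContinuousLinearMap.rotation (Real.pi / 4) p).1) := by
    have h := congrArg (Measure.map Prod.fst) hμ
    rw [Measure.map_map measurable_fst (by fun_prop), measurePreserving_fst.map_eq] at h
    exact h.symm
  have h2 : √2 * η * (√2 / 2) = η := by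
    have := Real.mul_self_sqrt (show (0 : ℝ) ≤ 2 by norm_num)
    linear_combination (η / 2) * this
  conv_lhs => rw [hfst]
  rw [covariance_map_fun (Continuous.aestronglyMeasurable (by fun_prop))
    (Continuous.aestronglyMeasurable (by fun_prop)) (by fun_prop)]
  simp only [ContinuousLinearMap.rotation_apply, Real.cos_pi_div_four, Real.sin_pi_div_four,
    Prod.fst_add, Prod.snd_add, Prod.smul_fst, Prod.smul_snd, smul_add, smul_smul, h2]

/-- A two-sided covariance bound at scale `η` with error `e`, valid for the whole class of
functions, propagates to scale `√2 * η` with error `2 * e`. -/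
lemma covariance_bounds_sqrt_two_mul {μ : Measure (E₁ × E₂)} [IsProbabilityMeasure μ]
    (hμ : (μ.prod μ).map (ContinuousLinearMap.rotation (Real.pi / 4)) = μ.prod μ)
    {S₁ : Set (StrongDual ℝ E₁)} {S₂ : Set (StrongDual ℝ E₂)} {R M₁ M₂ : ℝ}
    (hc₁ : Convex ℝ S₁) (hc₂ : Convex ℝ S₂) (hS₁ : IsClosed S₁) (hS₂ : IsClosed S₂)
    (hR₁ : ∀ a ∈ S₁, ‖a‖ ≤ R) (hR₂ : ∀ b ∈ S₂, ‖b‖ ≤ R) {A B η : ℝ}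
    (h : ∀ F ℓ H k, HasQuadraticExpansion S₁ M₁ F ℓ → HasQuadraticExpansion S₂ M₂ H k →
      cov[fun z => F (η • z.1), fun z => H (η • z.2); μ] ∈ Set.Icc A B) :
    ∀ F ℓ H k, HasQuadraticExpansion S₁ M₁ F ℓ → HasQuadraticExpansion S₂ M₂ H k →
      cov[fun z => F ((√2 * η) • z.1), fun z => H ((√2 * η) • z.2); μ]
        ∈ Set.Icc (2 * A) (2 * B) := by
  intro F ℓ H k hF hH
  have hcF := hF.continuous
  have hcH := hH.continuous
  rw [covariance_sqrt_two_mul hμ hF.continuous hH.continuous,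
    covariance_prod_eq_add (Continuous.measurable (by fun_prop))
      (Continuous.measurable (by fun_prop)) (fun p => hF.abs_le_one _) (fun p => hH.abs_le_one _)]
  have h1 (z : E₁ × E₂) := h _ _ _ _ (hF.translate (η • z.1)) (hH.translate (η • z.2))
  have h2 := h _ _ _ _
    (hF.average (P := μ) (U := fun w => η • w.1) (by fun_prop) hc₁ hS₁ hR₁)
    (hH.average (P := μ) (U := fun w => η • w.2) (by fun_prop) hc₂ hS₂ hR₂)
  have h3 : ∫ z, cov[fun w => F (η • z.1 + η • w.1), fun w => H (η • z.2 + η • w.2); μ] ∂μ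
      ∈ Set.Icc A B := by
    refine (convex_Icc A B).integral_mem isClosed_Icc (.of_forall h1) ?_
    refine .of_bound (C := max |A| |B|) ?_ (.of_forall fun z => abs_le_max_abs_abs (h1 z).1 (h1 z).2)
    have e (z : E₁ × E₂) :
        cov[fun w => F (η • z.1 + η • w.1), fun w => H (η • z.2 + η • w.2); μ]
        = ∫ w, F (η • z.1 + η • w.1) * H (η • z.2 + η • w.2) ∂μ
          - (∫ w, F (η • z.1 + η • w.1) ∂μ) * ∫ w, H (η • z.2 + η • w.2) ∂μ :=
      covariance_eq_sub (hF.memLp_two_comp (by fun_prop)) (hH.memLp_two_comp (by fun_prop))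
    simp_rw [e]
    have m1 : StronglyMeasurable fun p : (E₁ × E₂) × (E₁ × E₂) => F (η • p.1.1 + η • p.2.1) :=
      Continuous.stronglyMeasurable (by fun_prop)
    have m2 : StronglyMeasurable fun p : (E₁ × E₂) × (E₁ × E₂) => H (η • p.1.2 + η • p.2.2) :=
      Continuous.stronglyMeasurable (by fun_prop)
    exact ((m1.mul m2).integral_prod_right.sub
      (m1.integral_prod_right.mul m2.integral_prod_right)).aestronglyMeasurable
  exact ⟨by linarith [h2.1, h3.1], by linarith [h2.2, h3.2]⟩

/-- For a centred Gaussian vector `(X, Y)`, the covariance of `F X` and `H Y` is bounded by the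
extreme values of the covariances of `a X` and `b Y`, where `a` and `b` range over sets containing
the derivatives of `F` and `H`. -/
theorem covariance_mem_Icc_of_hasQuadraticExpansion [CompleteSpace E₁] [CompleteSpace E₂]
    {μ : Measure (E₁ × E₂)} [IsGaussian μ]
    (hμ : μ[id] = 0)
    {S₁ : Set (StrongDual ℝ E₁)} {S₂ : Set (StrongDual ℝ E₂)} {R M₁ M₂ : ℝ}
    (hc₁ : Convex ℝ S₁) (hc₂ : Convex ℝ S₂) (hS₁ : IsClosed S₁) (hS₂ : IsClosed S₂)
    (hR : 0 ≤ R) (hM₁ : 0 ≤ M₁) (hM₂ : 0 ≤ M₂)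
    (hR₁ : ∀ a ∈ S₁, ‖a‖ ≤ R) (hR₂ : ∀ b ∈ S₂, ‖b‖ ≤ R) {A B : ℝ}
    (hAB : ∀ a ∈ S₁, ∀ b ∈ S₂, cov[fun z => a z.1, fun z => b z.2; μ] ∈ Set.Icc A B)
    {F : E₁ → ℝ} {ℓ : E₁ → StrongDual ℝ E₁} {H : E₂ → ℝ} {k : E₂ → StrongDual ℝ E₂}
    (hF : HasQuadraticExpansion S₁ M₁ F ℓ) (hH : HasQuadraticExpansion S₂ M₂ H k) :
    cov[fun z => F z.1, fun z => H z.2; μ] ∈ Set.Icc A B := by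
  have hrot := IsGaussian.map_rotation_eq_self hμ (Real.pi / 4)
  have h2 : Integrable (fun z => ‖z‖ ^ 2) μ :=
    (IsGaussian.memLp_id μ 2 (by simp)).integrable_norm_pow (by norm_num)
  have h4 : Integrable (fun z => ‖z‖ ^ 4) μ :=
    (IsGaussian.memLp_id μ 4 (by simp)).integrable_norm_pow (by norm_num)
  obtain ⟨C, hC0, hC⟩ := exists_abs_covariance_sub_le μ h2 h4 hR hM₁ hM₂ hR₁ hR₂
  have hr0 : (0 : ℝ) < √2 := by positivity
  have hr2 : √2 ^ 2 = (2 : ℝ) := Real.sq_sqrt (by norm_num)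
  have hr1 : (1 : ℝ) < √2 := by
    nlinarith
  -- After `n` doublings starting from scale `q`, the local estimate gives an error `2 ^ n * q ^ 3`.
  have key (q : ℝ) (hq0 : 0 ≤ q) (hq1 : q ≤ 1) (n : ℕ) :
      ∀ F ℓ H k, HasQuadraticExpansion S₁ M₁ F ℓ → HasQuadraticExpansion S₂ M₂ H k →
      cov[fun z => F ((√2 ^ n * q) • z.1), fun z => H ((√2 ^ n * q) • z.2); μ]
        ∈ Set.Icc (2 ^ n * (q ^ 2 * A - C * q ^ 3)) (2 ^ n * (q ^ 2 * B + C * q ^ 3)) := by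
    induction n with
    | zero =>
      intro F ℓ H k hF hH
      have h := abs_le.1 (hC F ℓ H k hF hH q hq0 hq1)
      have hAB' := hAB _ (hF.deriv_mem 0) _ (hH.deriv_mem 0)
      have l1 := mul_le_mul_of_nonneg_left hAB'.1 (sq_nonneg q)
      have l2 := mul_le_mul_of_nonneg_left hAB'.2 (sq_nonneg q)
      simp only [pow_zero, one_mul]
      exact ⟨by linarith [h.1], by linarith [h.2]⟩
    | succ n ih =>
      have h := covariance_bounds_sqrt_two_mul hrot hc₁ hc₂ hS₁ hS₂ hR₁ hR₂ ih
      rw [pow_succ' (√2), mul_assoc, pow_succ' (2 : ℝ), mul_assoc, mul_assoc]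
      exact h
  have key' (n : ℕ) : cov[fun z => F z.1, fun z => H z.2; μ]
      ∈ Set.Icc (A - C * (√2)⁻¹ ^ n) (B + C * (√2)⁻¹ ^ n) := by
    have hq0 : (0 : ℝ) ≤ (√2)⁻¹ ^ n := by positivity
    have h := key ((√2)⁻¹ ^ n) hq0
      (pow_le_one₀ (by positivity) (inv_le_one_of_one_le₀ hr1.le)) n F ℓ H k hF hH
    have e1 : √2 ^ n * (√2)⁻¹ ^ n = 1 := by
      rw [← mul_pow, mul_inv_cancel₀ hr0.ne', one_pow]
    have e2 : (2 : ℝ) ^ n * ((√2)⁻¹ ^ n) ^ 2 = 1 := by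
      calc (2 : ℝ) ^ n * ((√2)⁻¹ ^ n) ^ 2 = (√2 ^ 2) ^ n * ((√2)⁻¹ ^ n) ^ 2 := by rw [hr2]
        _ = (√2 ^ n * (√2)⁻¹ ^ n) ^ 2 := by ring
        _ = 1 := by rw [e1, one_pow]
    simp only [e1, one_smul] at h
    generalize (√2)⁻¹ ^ n = q at *
    have e3 : (2 : ℝ) ^ n * (q ^ 2 * A - C * q ^ 3) = A - C * q := by
      linear_combination (A - C * q) * e2
    have e4 : (2 : ℝ) ^ n * (q ^ 2 * B + C * q ^ 3) = B + C * q := by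
      linear_combination (B + C * q) * e2
    rwa [e3, e4] at h
  have hlim : Filter.Tendsto (fun n : ℕ => C * (√2)⁻¹ ^ n) Filter.atTop (nhds 0) := by
    have := (tendsto_pow_atTop_nhds_zero_of_lt_one (r := (√2)⁻¹) (by positivity)
      (inv_lt_one_of_one_lt₀ hr1)).const_mul C
    simpa using this
  constructor
  · refine le_of_tendsto (x := Filter.atTop) (f := fun n : ℕ => A - C * (√2)⁻¹ ^ n)
      ?_ (.of_forall fun n => (key' n).1)
    simpa using hlim.const_sub A
  · refine ge_of_tendsto (x := Filter.atTop) (f := fun n : ℕ => B + C * (√2)⁻¹ ^ n)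
      ?_ (.of_forall fun n => (key' n).2)
    simpa using hlim.const_add B

end Gaussian

/-! ### Increasing functions of finitely many coordinates -/

/-- The linear forms on `ι → ℝ` with nonnegative coefficients of sum at most `L`: these are the
possible derivatives of a function satisfying `IsSprinklable L`. -/
def nonnegForms (ι : Type*) [Fintype ι] (L : ℝ) : Set (StrongDual ℝ (ι → ℝ)) :=
  {a | (∀ h, 0 ≤ h → 0 ≤ a h) ∧ a 1 ≤ L}

/-- A `[0, 1]`-valued increasing function on `ι → ℝ` that grows at rate at most `L` when the same
constant is added to every coordinate. -/
structure IsSprinklable {ι : Type*} (L : ℝ) (G : (ι → ℝ) → ℝ) : Prop where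
  nonneg : ∀ x, 0 ≤ G x
  le_one : ∀ x, G x ≤ 1
  le_add : ∀ x y c, 0 ≤ c → (∀ i, x i ≤ y i + c) → G x ≤ G y + L * c

section nonnegForms

variable {ι : Type*} [Fintype ι] {L : ℝ}

lemma convex_nonnegForms : Convex ℝ (nonnegForms ι L) := by
  rintro a ⟨ha, ha1⟩ b ⟨hb, hb1⟩ s t hs ht hst
  refine ⟨fun h hh => ?_, ?_⟩
  · have := ha h hh
    have := hb h hh
    simp only [add_apply, smul_apply, smul_eq_mul]
    positivity
  · simp only [add_apply, smul_apply, smul_eq_mul]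
    calc s * a 1 + t * b 1 ≤ s * L + t * L := by gcongr
      _ = L := by rw [← add_mul, hst, one_mul]

lemma isClosed_nonnegForms : IsClosed (nonnegForms ι L) := by
  have h1 (h : ι → ℝ) : Continuous fun a : StrongDual ℝ (ι → ℝ) => a h := by fun_prop
  have : nonnegForms ι L = (⋂ h : ι → ℝ, ⋂ _ : 0 ≤ h, {a | 0 ≤ a h}) ∩ {a | a 1 ≤ L} := by
    ext a
    simp [nonnegForms]
  rw [this]
  exact (isClosed_iInter fun h => isClosed_iInter fun _ => isClosed_le continuous_const (h1 h)).inter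
    (isClosed_le (h1 1) continuous_const)

lemma norm_le_of_mem_nonnegForms (hL : 0 ≤ L) {a : StrongDual ℝ (ι → ℝ)}
    (ha : a ∈ nonnegForms ι L) : ‖a‖ ≤ L := by
  refine a.opNorm_le_bound hL fun h => ?_
  have h1 : 0 ≤ ‖h‖ • (1 : ι → ℝ) - h := fun i => by
    have := (le_abs_self _).trans (norm_le_pi_norm h i)
    simpa using this
  have h2 : 0 ≤ ‖h‖ • (1 : ι → ℝ) + h := fun i => by
    have := (neg_abs_le _).trans' (neg_le_neg (norm_le_pi_norm h i))
    simp only [Pi.zero_apply, Pi.add_apply, Pi.smul_apply, Pi.one_apply, smul_eq_mul, mul_one]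
    linarith
  have e1 := ha.1 _ h1
  have e2 := ha.1 _ h2
  rw [map_sub, map_smul, smul_eq_mul] at e1
  rw [map_add, map_smul, smul_eq_mul] at e2
  have e3 : ‖h‖ * a 1 ≤ L * ‖h‖ := by
    rw [mul_comm L]
    exact mul_le_mul_of_nonneg_left ha.2 (norm_nonneg _)
  rw [Real.norm_eq_abs, abs_le]
  constructor <;> linarith

lemma apply_eq_sum_single [DecidableEq ι] (a : StrongDual ℝ (ι → ℝ)) (x : ι → ℝ) :
    a x = ∑ i, a (Pi.single i 1) * x i := by
  have := (a : (ι → ℝ) →ₗ[ℝ] ℝ).pi_apply_eq_sum_univ x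
  simp only [ContinuousLinearMap.coe_coe, smul_eq_mul] at this
  rw [this]
  refine Finset.sum_congr rfl fun i _ => ?_
  rw [mul_comm]
  congr 2
  funext j
  simp [Pi.single_apply, eq_comm]

/-- Covariances of linear forms in the class are controlled by the extreme pairwise covariances. -/
lemma covariance_mem_Icc_of_mem_nonnegForms {κ Ω : Type*} [Fintype κ] [MeasurableSpace Ω]
    {P : Measure Ω} [IsProbabilityMeasure P] {X : Ω → ι → ℝ} {Y : Ω → κ → ℝ}
    (hX : ∀ i, MemLp (fun ω => X ω i) 2 P) (hY : ∀ j, MemLp (fun ω => Y ω j) 2 P)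
    {m k : ℝ} (hm : m ≤ 0) (hk : 0 ≤ k)
    (hK : ∀ i j, cov[fun ω => X ω i, fun ω => Y ω j; P] ∈ Set.Icc m k)
    {a : StrongDual ℝ (ι → ℝ)} {b : StrongDual ℝ (κ → ℝ)} (hL : 0 ≤ L)
    (ha : a ∈ nonnegForms ι L) (hb : b ∈ nonnegForms κ L) :
    cov[fun ω => a (X ω), fun ω => b (Y ω); P] ∈ Set.Icc (L ^ 2 * m) (L ^ 2 * k) := by
  classical
  have eX : (fun ω => a (X ω)) = fun ω => ∑ i, a (Pi.single i 1) * X ω i :=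
    funext fun ω => apply_eq_sum_single a _
  have eY : (fun ω => b (Y ω)) = fun ω => ∑ j, b (Pi.single j 1) * Y ω j :=
    funext fun ω => apply_eq_sum_single b _
  rw [eX, eY, covariance_fun_sum_fun_sum (fun i => (hX i).const_mul _) (fun j => (hY j).const_mul _)]
  simp_rw [covariance_const_mul_left, covariance_const_mul_right]
  have ha0 (i : ι) : 0 ≤ a (Pi.single i 1) := ha.1 _ (Pi.single_nonneg.2 zero_le_one)
  have hb0 (j : κ) : 0 ≤ b (Pi.single j 1) := hb.1 _ (Pi.single_nonneg.2 zero_le_one)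
  have ha1 : ∑ i, a (Pi.single i 1) ≤ L := by
    have := apply_eq_sum_single a 1
    simp only [Pi.one_apply, mul_one] at this
    exact this ▸ ha.2
  have hb1 : ∑ j, b (Pi.single j 1) ≤ L := by
    have := apply_eq_sum_single b 1
    simp only [Pi.one_apply, mul_one] at this
    exact this ▸ hb.2
  have hab : (∑ i, a (Pi.single i 1)) * (∑ j, b (Pi.single j 1)) ≤ L ^ 2 := by
    rw [sq]
    exact mul_le_mul ha1 hb1 (Finset.sum_nonneg fun j _ => hb0 j) hL
  have e (c : ℝ) : ∑ i, ∑ j, a (Pi.single i 1) * (b (Pi.single j 1) * c)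
      = (∑ i, a (Pi.single i 1)) * (∑ j, b (Pi.single j 1)) * c := by
    simp_rw [Finset.sum_mul_sum, Finset.sum_mul, mul_assoc]
  constructor
  · calc L ^ 2 * m ≤ (∑ i, a (Pi.single i 1)) * (∑ j, b (Pi.single j 1)) * m :=
        mul_le_mul_of_nonpos_right hab hm
      _ = _ := (e m).symm
      _ ≤ _ := Finset.sum_le_sum fun i _ => Finset.sum_le_sum fun j _ =>
        mul_le_mul_of_nonneg_left (mul_le_mul_of_nonneg_left (hK i j).1 (hb0 j)) (ha0 i)
  · calc _ ≤ ∑ i, ∑ j, a (Pi.single i 1) * (b (Pi.single j 1) * k) :=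
        Finset.sum_le_sum fun i _ => Finset.sum_le_sum fun j _ =>
          mul_le_mul_of_nonneg_left (mul_le_mul_of_nonneg_left (hK i j).2 (hb0 j)) (ha0 i)
      _ = _ := e k
      _ ≤ L ^ 2 * k := mul_le_mul_of_nonneg_right hab hk

end nonnegForms

lemma nonpos_of_forall_pos_le_mul {a b : ℝ} (h : ∀ t : ℝ, 0 < t → a ≤ t * b) : a ≤ 0 := by
  have hlim : Filter.Tendsto (fun t : ℝ => t * b) (nhdsWithin 0 (Set.Ioi 0)) (nhds 0) := by
    have : Filter.Tendsto (fun t : ℝ => t * b) (nhds 0) (nhds (0 * b)) :=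
      (Continuous.tendsto (by fun_prop) 0)
    rw [zero_mul] at this
    exact this.mono_left nhdsWithin_le_nhds
  exact ge_of_tendsto hlim (Filter.eventually_of_mem self_mem_nhdsWithin h)

namespace IsSprinklable

variable {ι : Type*} [Fintype ι] {L : ℝ} {G : (ι → ℝ) → ℝ}

lemma abs_sub_le (hG : IsSprinklable L G) (x y : ι → ℝ) : |G x - G y| ≤ L * ‖x - y‖ := by
  have h (x y : ι → ℝ) : G x - G y ≤ L * ‖x - y‖ := by
    have := hG.le_add x y ‖x - y‖ (norm_nonneg _) fun i => by
      have := (le_abs_self _).trans (norm_le_pi_norm (x - y) i)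
      rw [Pi.sub_apply] at this
      linarith
    linarith
  rw [abs_le]
  have h2 := h y x
  rw [norm_sub_rev] at h2
  exact ⟨by linarith, h x y⟩

lemma continuous (hG : IsSprinklable L G) (hL : 0 ≤ L) : Continuous G := by
  refine LipschitzWith.continuous (K := L.toNNReal) (LipschitzWith.of_dist_le_mul fun x y => ?_)
  rw [Real.dist_eq, dist_eq_norm, Real.coe_toNNReal L hL]
  exact hG.abs_sub_le x y

/-- A derivative of a sprinklable function is a form with nonnegative coefficients of sum at
most `L`. -/
lemma mem_nonnegForms (hG : IsSprinklable L G) {M : ℝ} {x : ι → ℝ} {a : StrongDual ℝ (ι → ℝ)}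
    (h : ∀ h, |G (x + h) - G x - a h| ≤ M * ‖h‖ ^ 2) : a ∈ nonnegForms ι L := by
  have key (v : ι → ℝ) (t : ℝ) (ht : 0 < t) :
      |G (x + t • v) - G x - t * a v| ≤ t * (t * (M * ‖v‖ ^ 2)) := by
    have := h (t • v)
    rw [map_smul, smul_eq_mul, norm_smul, Real.norm_eq_abs, abs_of_pos ht] at this
    calc _ ≤ _ := this
      _ = _ := by ring
  refine ⟨fun v hv => ?_, ?_⟩
  · refine neg_nonpos.1 (nonpos_of_forall_pos_le_mul (b := M * ‖v‖ ^ 2) fun t ht => ?_)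
    have h1 := (abs_le.1 (key v t ht)).2
    have h2 := hG.le_add x (x + t • v) 0 le_rfl fun i => by
      have : 0 ≤ t * v i := mul_nonneg ht.le (hv i)
      simpa using this
    have h3 : t * -a v ≤ t * (t * (M * ‖v‖ ^ 2)) := by linarith
    exact le_of_mul_le_mul_left h3 ht
  · refine sub_nonpos.1
      (nonpos_of_forall_pos_le_mul (b := M * ‖(1 : ι → ℝ)‖ ^ 2) fun t ht => ?_)
    have h1 := (abs_le.1 (key 1 t ht)).1
    have h2 := hG.le_add (x + t • 1) x t ht.le fun i => by simp
    have h3 : t * (a 1 - L) ≤ t * (t * (M * ‖(1 : ι → ℝ)‖ ^ 2)) := by linarith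
    exact le_of_mul_le_mul_left h3 ht

open scoped Convolution in
/-- Convolution with a smooth bump function approximates a sprinklable function uniformly by
functions with a quadratic Taylor expansion. -/
lemma exists_hasQuadraticExpansion (hG : IsSprinklable L G) (hL : 0 ≤ L) {δ : ℝ} (hδ : 0 < δ) :
    ∃ F ℓ M, 0 ≤ M ∧ HasQuadraticExpansion (nonnegForms ι L) M F ℓ ∧
      ∀ x, |F x - G x| ≤ L * δ := by
  let φ : ContDiffBump (0 : ι → ℝ) := ⟨δ / 2, δ, by positivity, by linarith⟩
  set ρ : (ι → ℝ) → ℝ := φ.normed volume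
  have hρc : HasCompactSupport ρ := φ.hasCompactSupport_normed
  have hρd : ContDiff ℝ 1 ρ := φ.contDiff_normed
  have hρ0 (t : ι → ℝ) : 0 ≤ ρ t := φ.nonneg_normed t
  have hρ1 : ∫ t, ρ t = 1 := φ.integral_normed
  have hGc := hG.continuous hL
  have hρi : Integrable ρ := hρd.continuous.integrable_of_hasCompactSupport hρc
  set F : (ι → ℝ) → ℝ := ρ ⋆[ContinuousLinearMap.lsmul ℝ ℝ, volume] G
  have hFx (x : ι → ℝ) : F x = ∫ t, ρ t * G (x - t) := rfl
  have hFi (x : ι → ℝ) : Integrable fun t => ρ t * G (x - t) :=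
    hρc.convolutionExists_left (ContinuousLinearMap.lsmul ℝ ℝ) hρd.continuous
      hGc.locallyIntegrable x
  have hFS : IsSprinklable L F := by
    refine ⟨fun x => ?_, fun x => ?_, fun x y c hc hxy => ?_⟩
    · rw [hFx]
      exact integral_nonneg fun t => mul_nonneg (hρ0 t) (hG.nonneg _)
    · rw [hFx, ← hρ1]
      exact integral_mono (hFi x) hρi fun t => mul_le_of_le_one_right (hρ0 t) (hG.le_one _)
    · calc F x ≤ ∫ t, (ρ t * G (y - t) + ρ t * (L * c)) := by
            rw [hFx]
            refine integral_mono (hFi x) ((hFi y).add (hρi.mul_const _)) fun t => ?_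
            have := hG.le_add (x - t) (y - t) c hc fun i => by
              have := hxy i
              simp only [Pi.sub_apply]
              linarith
            have := mul_le_mul_of_nonneg_left this (hρ0 t)
            simp only
            linarith
        _ = F y + L * c := by
            rw [integral_add (hFi y) (hρi.mul_const _), integral_mul_const, hρ1, one_mul, hFx]
  set B := (ContinuousLinearMap.lsmul ℝ ℝ : ℝ →L[ℝ] ℝ →L[ℝ] ℝ).precompL (ι → ℝ) with hB
  have hB1 (a : StrongDual ℝ (ι → ℝ)) (b : ℝ) : ‖B a b‖ ≤ ‖a‖ * ‖b‖ := by
    refine ContinuousLinearMap.opNorm_le_bound _ (by positivity) fun v => ?_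
    rw [hB, ContinuousLinearMap.precompL_apply, ContinuousLinearMap.lsmul_apply, smul_eq_mul,
      norm_mul, mul_right_comm]
    gcongr
    exact a.le_opNorm v
  set ℓ : (ι → ℝ) → StrongDual ℝ (ι → ℝ) := fderiv ℝ ρ ⋆[B, volume] G
  have hderiv (x : ι → ℝ) : HasFDerivAt F (ℓ x) x :=
    hρc.hasFDerivAt_convolution_left _ hρd hGc.locallyIntegrable x
  have hDc : Continuous (fderiv ℝ ρ) := hρd.continuous_fderiv one_ne_zero
  have hDi : Integrable fun t => ‖fderiv ℝ ρ t‖ :=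
    hDc.norm.integrable_of_hasCompactSupport (hρc.fderiv ℝ).norm
  have hℓi (x : ι → ℝ) : Integrable fun t => B (fderiv ℝ ρ t) (G (x - t)) :=
    (hρc.fderiv ℝ).convolutionExists_left B hDc hGc.locallyIntegrable x
  set M := L * ∫ t, ‖fderiv ℝ ρ t‖
  have hM0 : 0 ≤ M := mul_nonneg hL (integral_nonneg fun t => norm_nonneg _)
  -- The derivative inherits the Lipschitz property of `G`, since it is a convolution with `G`.
  have hℓL (x y : ι → ℝ) : ‖ℓ x - ℓ y‖ ≤ M * ‖x - y‖ := by
    have e : ℓ x - ℓ y = ∫ t, B (fderiv ℝ ρ t) (G (x - t) - G (y - t)) := by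
      simp_rw [map_sub]
      rw [integral_sub (hℓi x) (hℓi y)]
      rfl
    rw [e]
    have hb : Integrable fun t => L * ‖x - y‖ * ‖fderiv ℝ ρ t‖ := hDi.const_mul _
    refine (norm_integral_le_of_norm_le hb (.of_forall fun t => ?_)).trans_eq ?_
    · calc ‖B (fderiv ℝ ρ t) (G (x - t) - G (y - t))‖
          ≤ ‖fderiv ℝ ρ t‖ * ‖G (x - t) - G (y - t)‖ := hB1 _ _
        _ ≤ ‖fderiv ℝ ρ t‖ * (L * ‖x - y‖) := by
          gcongr
          have := hG.abs_sub_le (x - t) (y - t)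
          rwa [sub_sub_sub_cancel_right] at this
        _ = _ := by ring
    · rw [integral_const_mul]
      ring
  have htaylor (x h : ι → ℝ) : |F (x + h) - F x - ℓ x h| ≤ M * ‖h‖ ^ 2 := by
    have := (convex_closedBall x ‖h‖).norm_image_sub_le_of_norm_hasFDerivWithin_le'
      (f := F) (f' := ℓ) (φ := ℓ x) (C := M * ‖h‖) (x := x) (y := x + h)
      (fun y _ => (hderiv y).hasFDerivWithinAt)
      (fun y hy => (hℓL y x).trans (by
        gcongr
        rwa [← mem_closedBall_iff_norm]))
      (Metric.mem_closedBall_self (norm_nonneg _)) (by simp)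
    rw [add_sub_cancel_left] at this
    calc _ ≤ _ := this
      _ = _ := by ring
  refine ⟨F, ℓ, M, hM0, ⟨?_, ?_, fun x => ?_, fun x => ?_, htaylor⟩, fun x => ?_⟩
  · exact hFS.continuous hL
  · refine LipschitzWith.continuous (K := M.toNNReal) (LipschitzWith.of_dist_le_mul fun x y => ?_)
    rw [dist_eq_norm, dist_eq_norm, Real.coe_toNNReal M hM0]
    exact hℓL x y
  · exact abs_le.2 ⟨by linarith [hFS.nonneg x], hFS.le_one x⟩
  · exact hFS.mem_nonnegForms (htaylor x)
  · rw [← Real.dist_eq]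
    refine φ.dist_normed_convolution_le hGc.aestronglyMeasurable fun y hy => ?_
    rw [Real.dist_eq]
    refine (hG.abs_sub_le y x).trans ?_
    gcongr
    rw [mem_ball_iff_norm] at hy
    exact hy.le

end IsSprinklable

/-! ### The covariance bound for finite-dimensional Gaussian vectors -/

lemma tendsto_covariance_of_abs_le_one {Ω : Type*} [MeasurableSpace Ω] {P : Measure Ω}
    [IsProbabilityMeasure P] {U V : ℕ → Ω → ℝ} {U' V' : Ω → ℝ}
    (hU : ∀ n, AEStronglyMeasurable (U n) P) (hV : ∀ n, AEStronglyMeasurable (V n) P)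
    (hU1 : ∀ n ω, |U n ω| ≤ 1) (hV1 : ∀ n ω, |V n ω| ≤ 1)
    (hUlim : ∀ ω, Filter.Tendsto (fun n => U n ω) Filter.atTop (nhds (U' ω)))
    (hVlim : ∀ ω, Filter.Tendsto (fun n => V n ω) Filter.atTop (nhds (V' ω))) :
    Filter.Tendsto (fun n => cov[U n, V n; P]) Filter.atTop (nhds cov[U', V'; P]) := by
  have hU' : AEStronglyMeasurable U' P :=
    aestronglyMeasurable_of_tendsto_ae _ hU (.of_forall hUlim)
  have hV' : AEStronglyMeasurable V' P :=
    aestronglyMeasurable_of_tendsto_ae _ hV (.of_forall hVlim)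
  have hU'1 (ω : Ω) : |U' ω| ≤ 1 := le_of_tendsto (hUlim ω).abs (.of_forall fun n => hU1 n ω)
  have hV'1 (ω : Ω) : |V' ω| ≤ 1 := le_of_tendsto (hVlim ω).abs (.of_forall fun n => hV1 n ω)
  have e (n : ℕ) : cov[U n, V n; P] = P[U n * V n] - P[U n] * P[V n] :=
    covariance_eq_sub (.of_bound (hU n) 1 (.of_forall (hU1 n)))
      (.of_bound (hV n) 1 (.of_forall (hV1 n)))
  simp_rw [e]
  rw [covariance_eq_sub (.of_bound hU' 1 (.of_forall hU'1)) (.of_bound hV' 1 (.of_forall hV'1))]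
  have lim (W : ℕ → Ω → ℝ) (W' : Ω → ℝ) (hW : ∀ n, AEStronglyMeasurable (W n) P)
      (hW1 : ∀ n ω, |W n ω| ≤ 1)
      (hWlim : ∀ ω, Filter.Tendsto (fun n => W n ω) Filter.atTop (nhds (W' ω))) :
      Filter.Tendsto (fun n => P[W n]) Filter.atTop (nhds P[W']) :=
    tendsto_integral_of_dominated_convergence (fun _ => 1) hW (integrable_const _)
      (fun n => .of_forall (hW1 n)) (.of_forall hWlim)
  refine (lim _ _ (fun n => (hU n).mul (hV n)) (fun n ω => ?_)
    (fun ω => (hUlim ω).mul (hVlim ω))).sub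
    ((lim _ _ hU hU1 hUlim).mul (lim _ _ hV hV1 hVlim))
  rw [Pi.mul_apply, abs_mul]
  exact mul_le_one₀ (hU1 n ω) (abs_nonneg _) (hV1 n ω)

lemma IsSprinklable.translate {ι : Type*} {L : ℝ} {G : (ι → ℝ) → ℝ}
    (hG : IsSprinklable L G) (a : ι → ℝ) :
    IsSprinklable L fun x => G (x + a) where
  nonneg x := hG.nonneg _
  le_one x := hG.le_one _
  le_add x y c hc h := hG.le_add _ _ c hc fun i => by
    have := h i
    simp only [Pi.add_apply]
    linarith

section

variable {ι κ Ω : Type*} [Fintype ι] [Fintype κ] [MeasurableSpace Ω] {P : Measure Ω}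
  {X : Ω → ι → ℝ} {Y : Ω → κ → ℝ} {L : ℝ} {G : (ι → ℝ) → ℝ} {H : (κ → ℝ) → ℝ} {m k : ℝ}

/-- The case of a centred vector, obtained by smoothing `G` and `H`. -/
lemma covariance_mem_Icc_of_isSprinklable_of_integral_eq_zero [IsProbabilityMeasure P]
    (hXY : HasGaussianLaw (fun ω => (X ω, Y ω)) P) (h0 : ∫ ω, (X ω, Y ω) ∂P = 0)
    (hL : 0 ≤ L) (hm : m ≤ 0) (hk : 0 ≤ k)
    (hK : ∀ i j, cov[fun ω => X ω i, fun ω => Y ω j; P] ∈ Set.Icc m k)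
    (hG : IsSprinklable L G) (hH : IsSprinklable L H) :
    cov[fun ω => G (X ω), fun ω => H (Y ω); P] ∈ Set.Icc (L ^ 2 * m) (L ^ 2 * k) := by
  have hXm : AEMeasurable X P := hXY.fst.aemeasurable
  have hYm : AEMeasurable Y P := hXY.snd.aemeasurable
  have hZm : AEMeasurable (fun ω => (X ω, Y ω)) P := hXY.aemeasurable
  have hgauss := hXY.isGaussian_map
  have hXL (i : ι) : MemLp (fun ω => X ω i) 2 P :=
    (hXY.fst.map_fun (ContinuousLinearMap.proj i)).memLp_two
  have hYL (j : κ) : MemLp (fun ω => Y ω j) 2 P :=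
    (hXY.snd.map_fun (ContinuousLinearMap.proj j)).memLp_two
  set μ := P.map (fun ω => (X ω, Y ω)) with hμ
  have hμ0 : μ[id] = 0 := by
    rw [hμ, integral_map hZm aestronglyMeasurable_id]
    exact h0
  have hδ (n : ℕ) : (0 : ℝ) < 1 / ((n : ℝ) + 1) := by positivity
  choose F ℓ M hM hF hFG using fun n : ℕ => hG.exists_hasQuadraticExpansion hL (hδ n)
  choose F' ℓ' M' hM' hF' hFH using fun n : ℕ => hH.exists_hasQuadraticExpansion hL (hδ n)
  have hn (n : ℕ) :
      cov[fun ω => F n (X ω), fun ω => F' n (Y ω); P] ∈ Set.Icc (L ^ 2 * m) (L ^ 2 * k) := by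
    have h := covariance_mem_Icc_of_hasQuadraticExpansion hμ0 convex_nonnegForms convex_nonnegForms
      isClosed_nonnegForms isClosed_nonnegForms hL (hM n) (hM' n)
      (fun a ha => norm_le_of_mem_nonnegForms hL ha) (fun b hb => norm_le_of_mem_nonnegForms hL hb)
      (A := L ^ 2 * m) (B := L ^ 2 * k) (fun a ha b hb => by
        rw [hμ, covariance_map_fun (Continuous.aestronglyMeasurable (by fun_prop))
          (Continuous.aestronglyMeasurable (by fun_prop)) hZm]
        exact covariance_mem_Icc_of_mem_nonnegForms hXL hYL hm hk hK hL ha hb) (hF n) (hF' n)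
    have hcF := (hF n).continuous
    have hcF' := (hF' n).continuous
    rwa [hμ, covariance_map_fun (Continuous.aestronglyMeasurable (by fun_prop))
      (Continuous.aestronglyMeasurable (by fun_prop)) hZm] at h
  have hlim (u : ℕ → ℝ) (v : ℝ) (h : ∀ n, |u n - v| ≤ L * (1 / ((n : ℝ) + 1))) :
      Filter.Tendsto u Filter.atTop (nhds v) := by
    refine tendsto_iff_dist_tendsto_zero.2 (squeeze_zero (fun n => dist_nonneg) h ?_)
    have := tendsto_one_div_add_atTop_nhds_zero_nat (𝕜 := ℝ) |>.const_mul L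
    simpa using this
  exact isClosed_Icc.mem_of_tendsto
    (tendsto_covariance_of_abs_le_one
      (fun n => ((hF n).integrable_comp hXm).aestronglyMeasurable)
      (fun n => ((hF' n).integrable_comp hYm).aestronglyMeasurable)
      (fun n ω => (hF n).abs_le_one _) (fun n ω => (hF' n).abs_le_one _)
      (fun ω => hlim _ _ fun n => hFG n (X ω)) (fun ω => hlim _ _ fun n => hFH n (Y ω)))
    (.of_forall hn)

/-- The covariance of `G X` and `H Y`, for a Gaussian vector `(X, Y)` and sprinklable `G` and `H`,
lies between `L ^ 2` times the extreme pairwise covariances. -/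
theorem covariance_mem_Icc_of_isSprinklable [IsProbabilityMeasure P]
    (hXY : HasGaussianLaw (fun ω => (X ω, Y ω)) P)
    (hL : 0 ≤ L) (hm : m ≤ 0) (hk : 0 ≤ k)
    (hK : ∀ i j, cov[fun ω => X ω i, fun ω => Y ω j; P] ∈ Set.Icc m k)
    (hG : IsSprinklable L G) (hH : IsSprinklable L H) :
    cov[fun ω => G (X ω), fun ω => H (Y ω); P] ∈ Set.Icc (L ^ 2 * m) (L ^ 2 * k) := by
  have hi := hXY.integrable
  have hgauss := hXY.isGaussian_map
  set c : (ι → ℝ) × (κ → ℝ) := ∫ ω, (X ω, Y ω) ∂P with hc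
  have hcent : HasGaussianLaw (fun ω => (X ω - c.1, Y ω - c.2)) P := by
    constructor
    have h : IsGaussian ((P.map fun ω => (X ω, Y ω)).map fun z => z - c) := inferInstance
    rwa [AEMeasurable.map_map_of_aemeasurable (by fun_prop) hXY.aemeasurable] at h
  have h0 : ∫ ω, (X ω - c.1, Y ω - c.2) ∂P = 0 := by
    have : ∫ ω, ((X ω, Y ω) - c) ∂P = 0 := by
      rw [integral_sub hi (integrable_const c), ← hc]
      simp
    exact this
  have hXi (i : ι) : Integrable (fun ω => X ω i) P :=
    (hXY.fst.map_fun (ContinuousLinearMap.proj i)).integrable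
  have hYi (j : κ) : Integrable (fun ω => Y ω j) P :=
    (hXY.snd.map_fun (ContinuousLinearMap.proj j)).integrable
  have h := covariance_mem_Icc_of_isSprinklable_of_integral_eq_zero hcent h0 hL hm hk
    (fun i j => by
      simp only [Pi.sub_apply]
      rw [covariance_sub_const_left (hXi i), covariance_sub_const_right (hYi j)]
      exact hK i j) (hG.translate c.1) (hH.translate c.2)
  simpa only [sub_add_cancel] using h

end

/-! ### Interpolation of continuous functions on a compact set -/

/-- A finite family of nodes in a compact set `S`, with a partition of unity on `S` subordinate to
the balls of radius `δ` around the nodes. -/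
lemma exists_nodes {T : Type*} [PseudoMetricSpace T] {S : Set T} (hS : IsCompact S) {δ : ℝ}
    (hδ : 0 < δ) : ∃ (n : ℕ) (p : Fin n → T) (φ : Fin n → C(T, ℝ)), (∀ i, p i ∈ S) ∧
      (∀ i x, 0 ≤ φ i x) ∧ (∀ x ∈ S, ∑ i, φ i x = 1) ∧
      ∀ i x, φ i x ≠ 0 → dist (p i) x < δ := by
  obtain ⟨t, htS, ht, hcov⟩ := hS.finite_cover_balls (half_pos hδ)
  obtain ⟨n, p, hp⟩ : ∃ (n : ℕ) (p : Fin n → T), Set.range p = t := by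
    have := ht.fintype
    exact ⟨Fintype.card t, fun i => (Fintype.equivFin t).symm i, by
      rw [← Function.comp_def, Set.range_comp, Equiv.range_eq_univ, Set.image_univ,
        Subtype.range_coe]⟩
  let τ : Fin n → C(T, ℝ) := fun i => ⟨fun x => max (δ - dist (p i) x) 0, by fun_prop⟩
  have hτ0 (i : Fin n) (x : T) : 0 ≤ τ i x := le_max_right _ _
  have hden (x : T) : 0 < max (∑ i, τ i x) (δ / 2) := lt_max_of_lt_right (half_pos hδ)
  -- The maximum with `δ / 2` keeps the denominator positive away from `S`; it is inactive on `S`,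
  -- where some `τ i` is at least `δ / 2`.
  refine ⟨n, p, fun i => ⟨fun x => τ i x / max (∑ j, τ j x) (δ / 2), ?_⟩, fun i => ?_,
    fun i x => ?_, fun x hx => ?_, fun i x hx => ?_⟩
  · exact Continuous.div (by fun_prop) (by fun_prop) fun x => (hden x).ne'
  · exact htS (hp ▸ Set.mem_range_self i)
  · exact div_nonneg (hτ0 i x) (hden x).le
  · obtain ⟨y, hy, hxy⟩ := Set.mem_iUnion₂.1 (hcov hx)
    rw [← hp] at hy
    obtain ⟨i, rfl⟩ := hy
    have h1 : δ / 2 ≤ τ i x := le_max_of_le_left (by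
      rw [Metric.mem_ball, dist_comm] at hxy
      linarith)
    have h2 : τ i x ≤ ∑ j, τ j x :=
      Finset.single_le_sum (f := fun j => τ j x) (fun j _ => hτ0 j x) (Finset.mem_univ i)
    simp only [ContinuousMap.coe_mk]
    rw [← Finset.sum_div, max_eq_left (h1.trans h2), div_self]
    linarith
  · by_contra! hd
    refine hx ?_
    have : τ i x = 0 := max_eq_right (by linarith)
    simp [this]

/-- The continuous function with values `y i` at the nodes of the partition of unity `φ`. -/
def interpolate {T ι : Type*} [TopologicalSpace T] [Fintype ι] (φ : ι → C(T, ℝ)) (y : ι → ℝ) :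
    C(T, ℝ) :=
  ∑ i, y i • φ i

lemma interpolate_apply {T ι : Type*} [TopologicalSpace T] [Fintype ι] (φ : ι → C(T, ℝ))
    (y : ι → ℝ) (x : T) : interpolate φ y x = ∑ i, y i * φ i x := by
  simp [interpolate]

/-- A `[0, 1]`-valued functional on `C(T, ℝ)` that is increasing, depends only on the restriction
to `S`, and grows at rate at most `L` when a constant is added. -/
structure IsSprinklableOn {T : Type*} [TopologicalSpace T] (L : ℝ) (S : Set T)
    (Φ : C(T, ℝ) → ℝ) : Prop where
  nonneg : ∀ g, 0 ≤ Φ g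
  le_one : ∀ g, Φ g ≤ 1
  le_add : ∀ g h c, 0 ≤ c → (∀ x ∈ S, g x ≤ h x + c) → Φ g ≤ Φ h + L * c

namespace IsSprinklableOn

variable {T : Type*} {L : ℝ} {S : Set T}

lemma abs_sub_le [TopologicalSpace T] {Φ : C(T, ℝ) → ℝ} (hΦ : IsSprinklableOn L S Φ)
    {g h : C(T, ℝ)} {c : ℝ} (hc : 0 ≤ c)
    (hgh : ∀ x ∈ S, |g x - h x| ≤ c) : |Φ g - Φ h| ≤ L * c := by
  have h1 := hΦ.le_add g h c hc fun x hx => by linarith [(abs_le.1 (hgh x hx)).2]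
  have h2 := hΦ.le_add h g c hc fun x hx => by linarith [(abs_le.1 (hgh x hx)).1]
  exact abs_le.2 ⟨by linarith, by linarith⟩

lemma abs_le_one [TopologicalSpace T] {Φ : C(T, ℝ) → ℝ} (hΦ : IsSprinklableOn L S Φ)
    (g : C(T, ℝ)) : |Φ g| ≤ 1 :=
  abs_le.2 ⟨by linarith [hΦ.nonneg g], hΦ.le_one g⟩

lemma isSprinklable_interpolate [TopologicalSpace T] {Φ : C(T, ℝ) → ℝ}
    (hΦ : IsSprinklableOn L S Φ) {ι : Type*} [Fintype ι] {φ : ι → C(T, ℝ)}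
    (hφ0 : ∀ i x, 0 ≤ φ i x) (hφ1 : ∀ x ∈ S, ∑ i, φ i x = 1) :
    IsSprinklable L fun y => Φ (interpolate φ y) where
  nonneg y := hΦ.nonneg _
  le_one y := hΦ.le_one _
  le_add y z c hc h := hΦ.le_add _ _ c hc fun x hx => by
    rw [interpolate_apply, interpolate_apply]
    calc ∑ i, y i * φ i x ≤ ∑ i, (z i + c) * φ i x :=
          Finset.sum_le_sum fun i _ => mul_le_mul_of_nonneg_right (h i) (hφ0 i x)
      _ = ∑ i, z i * φ i x + c := by
          simp_rw [add_mul, Finset.sum_add_distrib, ← Finset.mul_sum, hφ1 x hx, mul_one]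

/-- A sprinklable functional is the pointwise limit of functionals depending on the values of its
argument at finitely many points of the compact set `S`. -/
lemma exists_tendsto_interpolate [PseudoMetricSpace T] (hS : IsCompact S) (hL : 0 ≤ L)
    {Φ : C(T, ℝ) → ℝ} (hΦ : IsSprinklableOn L S Φ) :
    ∃ (N : ℕ → ℕ) (p : ∀ n, Fin (N n) → T) (G : ∀ n, (Fin (N n) → ℝ) → ℝ),
      (∀ n i, p n i ∈ S) ∧ (∀ n, IsSprinklable L (G n)) ∧
      ∀ g : C(T, ℝ), Filter.Tendsto (fun n => G n fun i => g (p n i)) Filter.atTop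
        (nhds (Φ g)) := by
  have hδ (n : ℕ) : (0 : ℝ) < 1 / ((n : ℝ) + 1) := by positivity
  choose N p φ hp hφ0 hφ1 hφ using fun n : ℕ => exists_nodes hS (hδ n)
  refine ⟨N, p, fun n y => Φ (interpolate (φ n) y), hp,
    fun n => hΦ.isSprinklable_interpolate (hφ0 n) (hφ1 n), fun g => ?_⟩
  rw [Metric.tendsto_atTop]
  intro ε hε
  have hη : 0 < ε / (L + 1) := by positivity
  obtain ⟨δ, hδ0, hδg⟩ := Metric.uniformContinuousOn_iff.1
    (hS.uniformContinuousOn_of_continuous g.continuous.continuousOn) _ hη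
  obtain ⟨n₀, hn₀⟩ := exists_nat_one_div_lt hδ0
  refine ⟨n₀, fun n hn => ?_⟩
  rw [Real.dist_eq]
  have hn' : 1 / ((n : ℝ) + 1) < δ := (one_div_le_one_div_of_le (by positivity)
    (by exact_mod_cast Nat.succ_le_succ hn)).trans_lt hn₀
  have hclose (x : T) (hx : x ∈ S) :
      |interpolate (φ n) (fun i => g (p n i)) x - g x| ≤ ε / (L + 1) := by
    have e : interpolate (φ n) (fun i => g (p n i)) x - g x
        = ∑ i, (g (p n i) - g x) * φ n i x := by
      simp_rw [interpolate_apply, sub_mul, Finset.sum_sub_distrib, ← Finset.mul_sum, hφ1 n x hx,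
        mul_one]
    rw [e]
    calc _ ≤ ∑ i, |(g (p n i) - g x) * φ n i x| := Finset.abs_sum_le_sum_abs _ _
      _ ≤ ∑ i, ε / (L + 1) * φ n i x := Finset.sum_le_sum fun i _ => by
          rw [abs_mul, abs_of_nonneg (hφ0 n i x)]
          by_cases h0 : φ n i x = 0
          · simp [h0]
          · have := hδg _ (hp n i) _ hx ((hφ n i x h0).trans hn')
            rw [Real.dist_eq] at this
            exact mul_le_mul_of_nonneg_right this.le (hφ0 n i x)
      _ = _ := by rw [← Finset.mul_sum, hφ1 n x hx, mul_one]
  calc _ ≤ L * (ε / (L + 1)) := hΦ.abs_sub_le hη.le hclose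
    _ < (L + 1) * (ε / (L + 1)) := by gcongr; linarith
    _ = ε := by field_simp

end IsSprinklableOn

/-! ### Gaussian processes with continuous paths -/

section GaussianProcess

variable {T Ω : Type*} [MeasurableSpace Ω] {P : Measure Ω}

lemma hasGaussianLaw_prodMk_eval {X : T → Ω → ℝ} (hX : IsGaussianProcess X P) {ι κ : Type*}
    [Fintype ι] [Fintype κ] (p : ι → T) (q : κ → T) :
    HasGaussianLaw (fun ω => ((fun i => X (p i) ω), (fun j => X (q j) ω))) P := by
  classical
  let I : Finset T := Finset.univ.image p ∪ Finset.univ.image q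
  have hp (i : ι) : p i ∈ I := Finset.mem_union_left _ (by simp)
  have hq (j : κ) : q j ∈ I := Finset.mem_union_right _ (by simp)
  exact (hX.hasGaussianLaw I).map_fun
    ((ContinuousLinearMap.pi fun i =>
        (ContinuousLinearMap.proj (⟨p i, hp i⟩ : I) : (I → ℝ) →L[ℝ] ℝ)).prod
      (ContinuousLinearMap.pi fun j =>
        (ContinuousLinearMap.proj (⟨q j, hq j⟩ : I) : (I → ℝ) →L[ℝ] ℝ)))

variable [PseudoMetricSpace T] {f : Ω → C(T, ℝ)} {L : ℝ} {S S₁ S₂ : Set T}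

lemma IsSprinklableOn.aestronglyMeasurable_comp (hf : IsGaussianProcess (fun x ω => f ω x) P)
    (hS : IsCompact S) (hL : 0 ≤ L) {Φ : C(T, ℝ) → ℝ} (hΦ : IsSprinklableOn L S Φ) :
    AEStronglyMeasurable (fun ω => Φ (f ω)) P := by
  obtain ⟨N, p, G, hp, hG, hlim⟩ := hΦ.exists_tendsto_interpolate hS hL
  refine aestronglyMeasurable_of_tendsto_ae Filter.atTop (fun n => ?_)
    (.of_forall fun ω => hlim (f ω))
  exact (((hG n).continuous hL).measurable.comp_aemeasurable
    (aemeasurable_pi_lambda _ fun i => hf.aemeasurable (p n i))).aestronglyMeasurable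

/-- The covariance of sprinklable functionals of a Gaussian process is controlled by the extreme
values of the covariance kernel on the supports. -/
theorem covariance_mem_Icc_of_isSprinklableOn [IsProbabilityMeasure P]
    (hf : IsGaussianProcess (fun x ω => f ω x) P)
    (hS₁ : IsCompact S₁) (hS₂ : IsCompact S₂) (hL : 0 ≤ L) {m k : ℝ} (hm : m ≤ 0) (hk : 0 ≤ k)
    (hK : ∀ x ∈ S₁, ∀ y ∈ S₂, covKernel P f x y ∈ Set.Icc m k)
    {Φ Ψ : C(T, ℝ) → ℝ} (hΦ : IsSprinklableOn L S₁ Φ) (hΨ : IsSprinklableOn L S₂ Ψ) :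
    cov[fun ω => Φ (f ω), fun ω => Ψ (f ω); P] ∈ Set.Icc (L ^ 2 * m) (L ^ 2 * k) := by
  obtain ⟨N, p, G, hp, hG, hlim⟩ := hΦ.exists_tendsto_interpolate hS₁ hL
  obtain ⟨N', q, H, hq, hH, hlim'⟩ := hΨ.exists_tendsto_interpolate hS₂ hL
  refine isClosed_Icc.mem_of_tendsto
    (tendsto_covariance_of_abs_le_one
      (U := fun n ω => G n fun i => f ω (p n i)) (V := fun n ω => H n fun i => f ω (q n i))
      (fun n => ?_) (fun n => ?_) (fun n ω => ?_) (fun n ω => ?_)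
      (fun ω => hlim (f ω)) (fun ω => hlim' (f ω)))
    (.of_forall fun n => ?_)
  · exact (((hG n).continuous hL).measurable.comp_aemeasurable
      (aemeasurable_pi_lambda _ fun i => hf.aemeasurable (p n i))).aestronglyMeasurable
  · exact (((hH n).continuous hL).measurable.comp_aemeasurable
      (aemeasurable_pi_lambda _ fun i => hf.aemeasurable (q n i))).aestronglyMeasurable
  · exact abs_le.2 ⟨by linarith [(hG n).nonneg fun i => f ω (p n i)], (hG n).le_one _⟩
  · exact abs_le.2 ⟨by linarith [(hH n).nonneg fun i => f ω (q n i)], (hH n).le_one _⟩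
  · exact covariance_mem_Icc_of_isSprinklable (hasGaussianLaw_prodMk_eval hf (p n) (q n))
      hL hm hk (fun i j => hK _ (hp n i) _ (hq n j)) (hG n) (hH n)

/-- The variance of a Gaussian process with continuous paths is continuous: it can be read off
the modulus of the characteristic function, which is continuous by dominated convergence. -/
lemma continuous_variance (hf : IsGaussianProcess (fun x ω => f ω x) P) :
    Continuous fun x => Var[fun ω => f ω x; P] := by
  have hP := hf.isProbabilityMeasure
  set ψ : T → ℂ := fun x => ∫ ω, Complex.exp (f ω x * Complex.I) ∂P with hψ
  have hψc : Continuous ψ := by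
    refine continuous_of_dominated (bound := fun _ => 1) (fun x => ?_) (fun x => ?_)
      (integrable_const _) (.of_forall fun ω => by fun_prop)
    · have := (hf.aemeasurable x).aestronglyMeasurable
      exact (Continuous.comp_aestronglyMeasurable
        (g := fun r : ℝ => Complex.exp (r * Complex.I)) (by fun_prop) this)
    · exact .of_forall fun ω => (Complex.norm_exp_ofReal_mul_I _).le
  have hψn (x : T) : ‖ψ x‖ = Real.exp (-(Var[fun ω => f ω x; P] / 2)) := by
    have h := (hf.hasGaussianLaw_eval x).map_eq_gaussianReal
    have h1 : charFun (P.map fun ω => f ω x) 1 = ψ x := by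
      rw [charFun_apply_real, integral_map (hf.aemeasurable x)
        (Continuous.aestronglyMeasurable (by fun_prop))]
      simp [hψ]
    rw [← h1, h, charFun_gaussianReal, Complex.norm_exp]
    simp [variance_nonneg]
  have hV (x : T) : Var[fun ω => f ω x; P] = -2 * Real.log ‖ψ x‖ := by
    rw [hψn, Real.log_exp]
    ring
  simp_rw [hV]
  refine continuous_const.mul (hψc.norm.log fun x => ?_)
  rw [hψn]
  positivity

lemma bddAbove_abs_covKernel (hf : IsGaussianProcess (fun x ω => f ω x) P)
    (hS₁ : IsCompact S₁) (hS₂ : IsCompact S₂) :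
    BddAbove (Set.range fun p : S₁ × S₂ => |covKernel P f p.1 p.2|) := by
  have hP := hf.isProbabilityMeasure
  obtain ⟨a, ha⟩ := hS₁.bddAbove_image (continuous_variance hf).continuousOn
  obtain ⟨b, hb⟩ := hS₂.bddAbove_image (continuous_variance hf).continuousOn
  refine ⟨√a * √b, ?_⟩
  rintro _ ⟨⟨⟨x, hx⟩, ⟨y, hy⟩⟩, rfl⟩
  have hxa := ha (Set.mem_image_of_mem _ hx)
  have hyb := hb (Set.mem_image_of_mem _ hy)
  refine abs_covariance_le_mul (hf.hasGaussianLaw_eval x).memLp_two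
    (hf.hasGaussianLaw_eval y).memLp_two (Real.sqrt_nonneg _) (Real.sqrt_nonneg _) ?_ ?_
  · rwa [Real.sq_sqrt ((variance_nonneg _ _).trans hxa)]
  · rwa [Real.sq_sqrt ((variance_nonneg _ _).trans hyb)]

end GaussianProcess

/-! ### Sprinkling an increasing event -/

section Sprinkle

variable {T : Type*} [TopologicalSpace T] {A : Set C(T, ℝ)} {S : Set T} {ε : ℝ}

lemma mem_of_le_on (hi : IsIncreasing A) (hs : IsSupportedOn A S) {g h : C(T, ℝ)} (hg : g ∈ A)
    (hgh : ∀ x ∈ S, g x ≤ h x) : h ∈ A := by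
  -- Raise `g` to `max g h` first, then change it off `S` only.
  have h1 : g + ((h - g) ⊔ 0) ∈ A := hi _ (fun x => le_max_right _ _) g hg
  have h2 := (hs (h - (g + ((h - g) ⊔ 0))) (fun x hx => ?_) _).1 h1
  · rwa [add_sub_cancel] at h2
  · have : 0 ≤ h x - g x := sub_nonneg.2 (hgh x hx)
    simp [this]

/-- The admissible shifts in the definition of `sprinkle`: the levels `s ≥ 0` for which
`g + ε * s` lies in `A`, together with `1`. -/
def sprinkleLevels (ε : ℝ) (A : Set C(T, ℝ)) (g : C(T, ℝ)) : Set ℝ :=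
  insert 1 {s | 0 ≤ s ∧ g + ContinuousMap.const T (ε * s) ∈ A}

/-- The sprinkled indicator of an increasing event `A`: it is `1` on `A`, it vanishes unless
`g + ε ∈ A`, and in between it decreases linearly in the constant that has to be added to `g` to
reach `A`. -/
noncomputable def sprinkle (ε : ℝ) (A : Set C(T, ℝ)) (g : C(T, ℝ)) : ℝ :=
  1 - sInf (sprinkleLevels ε A g)

lemma sprinkleLevels_nonneg {g : C(T, ℝ)} {s : ℝ} (hs : s ∈ sprinkleLevels ε A g) : 0 ≤ s := by
  rcases hs with rfl | hs
  · exact zero_le_one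
  · exact hs.1

lemma sInf_sprinkleLevels_le {g : C(T, ℝ)} {s : ℝ} (hs : s ∈ sprinkleLevels ε A g) :
    sInf (sprinkleLevels ε A g) ≤ s :=
  csInf_le ⟨0, fun _ => sprinkleLevels_nonneg⟩ hs

lemma sprinkle_eq_one {g : C(T, ℝ)} (hg : g ∈ A) : sprinkle ε A g = 1 := by
  have h0 : (0 : ℝ) ∈ sprinkleLevels ε A g := by
    refine Set.mem_insert_of_mem _ ⟨le_rfl, ?_⟩
    rw [mul_zero]
    exact (add_zero g).symm ▸ hg
  have h1 : 0 ≤ sInf (sprinkleLevels ε A g) := Real.sInf_nonneg fun _ => sprinkleLevels_nonneg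
  rw [sprinkle, le_antisymm (sInf_sprinkleLevels_le h0) h1, sub_zero]

lemma mem_of_sprinkle_pos (hi : IsIncreasing A) (hε : 0 < ε) {g : C(T, ℝ)}
    (hg : 0 < sprinkle ε A g) : g + ContinuousMap.const T ε ∈ A := by
  obtain ⟨s, hs, hs1⟩ := exists_lt_of_csInf_lt ⟨1, Set.mem_insert _ _⟩ (sub_pos.1 hg)
  rcases hs with rfl | hs
  · exact absurd hs1 (lt_irrefl _)
  · have := hi (ContinuousMap.const T (ε * (1 - s)))
      (fun x => mul_nonneg hε.le (sub_nonneg.2 hs1.le)) _ hs.2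
    convert this using 1
    ext x
    simp only [ContinuousMap.add_apply, ContinuousMap.const_apply]
    ring

lemma isSprinklableOn_sprinkle (hi : IsIncreasing A) (hs : IsSupportedOn A S) (hε : 0 < ε) :
    IsSprinklableOn ε⁻¹ S (sprinkle ε A) where
  nonneg g := sub_nonneg.2 (sInf_sprinkleLevels_le (Set.mem_insert _ _))
  le_one g := sub_le_self _ (Real.sInf_nonneg fun _ => sprinkleLevels_nonneg)
  le_add g h c hc hgh := by
    have hc' : 0 ≤ ε⁻¹ * c := by positivity
    have key : sInf (sprinkleLevels ε A h) - ε⁻¹ * c ≤ sInf (sprinkleLevels ε A g) := by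
      refine le_csInf ⟨1, Set.mem_insert _ _⟩ fun s hs' => ?_
      rcases hs' with rfl | hs'
      · have : sInf (sprinkleLevels ε A h) ≤ 1 := sInf_sprinkleLevels_le (Set.mem_insert _ _)
        linarith
      · have : sInf (sprinkleLevels ε A h) ≤ s + ε⁻¹ * c := by
          refine sInf_sprinkleLevels_le (Set.mem_insert_of_mem _ ⟨add_nonneg hs'.1 hc', ?_⟩)
          refine mem_of_le_on hi hs hs'.2 fun x hx => ?_
          have e : ε * (s + ε⁻¹ * c) = ε * s + c := by field_simp
          simp only [ContinuousMap.add_apply, ContinuousMap.const_apply, e]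
          linarith [hgh x hx]
        linarith
    rw [sprinkle, sprinkle]
    linarith

lemma IsSprinklableOn.shift {L : ℝ} {Φ : C(T, ℝ) → ℝ} (hΦ : IsSprinklableOn L S Φ) (s : ℝ) :
    IsSprinklableOn L S fun g => Φ (g + ContinuousMap.const T s) where
  nonneg g := hΦ.nonneg _
  le_one g := hΦ.le_one _
  le_add g h c hc hgh := hΦ.le_add _ _ c hc fun x hx => by
    simp only [ContinuousMap.add_apply, ContinuousMap.const_apply]
    linarith [hgh x hx]

end Sprinkle

section Measure

variable {Ω : Type*} [MeasurableSpace Ω] {P : Measure Ω} [IsProbabilityMeasure P] {Z : Ω → ℝ}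
  {s : Set Ω}

/-- The set `s` is not assumed to be measurable. -/
lemma measureReal_le_integral_of_one_le (hZ : Integrable Z P) (h0 : ∀ ω, 0 ≤ Z ω)
    (h : ∀ ω ∈ s, 1 ≤ Z ω) : P.real s ≤ ∫ ω, Z ω ∂P := by
  have h1 := mul_meas_ge_le_integral_of_nonneg (.of_forall h0) hZ 1
  rw [one_mul] at h1
  exact (measureReal_mono h).trans h1

/-- The set `s` is not assumed to be measurable. -/
lemma integral_le_measureReal_of_pos (hZ : AEStronglyMeasurable Z P) (h0 : ∀ ω, 0 ≤ Z ω)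
    (h1 : ∀ ω, Z ω ≤ 1) (h : ∀ ω, 0 < Z ω → ω ∈ s) : ∫ ω, Z ω ∂P ≤ P.real s := by
  have hm : NullMeasurableSet {ω | 0 < Z ω} P := nullMeasurableSet_lt aemeasurable_const
    hZ.aemeasurable
  have hi : Integrable Z P :=
    .of_bound hZ 1 (.of_forall fun ω => by rw [Real.norm_of_nonneg (h0 ω)]; exact h1 ω)
  calc ∫ ω, Z ω ∂P ≤ ∫ ω, {ω | 0 < Z ω}.indicator (fun _ => (1 : ℝ)) ω ∂P := by
        refine integral_mono hi ((integrable_const (1 : ℝ)).indicator₀ hm) fun ω => ?_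
        by_cases hω : 0 < Z ω
        · simpa [Set.indicator, hω] using h1 ω
        · simpa [Set.indicator, hω] using le_of_not_gt hω
    _ = P.real {ω | 0 < Z ω} := by
        rw [integral_indicator₀ hm]
        simp
    _ ≤ P.real s := measureReal_mono h

end Measure

/-! ### The decoupling inequality -/

/-- Sprinkled decoupling in terms of a lower bound `m ≤ 0` and an upper bound `k ≥ 0` for the
covariance kernel on `S₁ × S₂`. -/
theorem sprinkled_decoupling {T Ω : Type*} [PseudoMetricSpace T] [MeasurableSpace Ω]
    {P : Measure Ω} [IsProbabilityMeasure P] {f : Ω → C(T, ℝ)}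
    (hf : IsGaussianProcess (fun x ω => f ω x) P) {S₁ S₂ : Set T}
    (hS₁ : IsCompact S₁) (hS₂ : IsCompact S₂) {m k : ℝ} (hm : m ≤ 0) (hk : 0 ≤ k)
    (hK : ∀ x ∈ S₁, ∀ y ∈ S₂, covKernel P f x y ∈ Set.Icc m k)
    {A₁ A₂ : Set C(T, ℝ)} (hi₁ : IsIncreasing A₁) (hi₂ : IsIncreasing A₂)
    (hs₁ : IsSupportedOn A₁ S₁) (hs₂ : IsSupportedOn A₂ S₂) {ε : ℝ} (hε : 0 < ε) :
    P.real {ω | f ω ∈ A₁ ∩ A₂} - shiftProb P f ε A₁ * shiftProb P f ε A₂ ≤ k / ε ^ 2 ∧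
    shiftProb P f (-ε) A₁ * shiftProb P f (-ε) A₂ - P.real {ω | f ω ∈ A₁ ∩ A₂}
      ≤ -m / ε ^ 2 := by
  have hL : 0 ≤ ε⁻¹ := (inv_pos.2 hε).le
  have hΦ₁ := isSprinklableOn_sprinkle hi₁ hs₁ hε
  have hΦ₂ := isSprinklableOn_sprinkle hi₂ hs₂ hε
  have hint {S : Set T} (hS : IsCompact S) {Φ : C(T, ℝ) → ℝ} (hΦ : IsSprinklableOn ε⁻¹ S Φ) :
      MemLp (fun ω => Φ (f ω)) 2 P :=
    .of_bound (hΦ.aestronglyMeasurable_comp hf hS hL) 1 (.of_forall fun ω => hΦ.abs_le_one _)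
  have hcov {Φ Ψ : C(T, ℝ) → ℝ} (hΦ : IsSprinklableOn ε⁻¹ S₁ Φ) (hΨ : IsSprinklableOn ε⁻¹ S₂ Ψ) :
      ∫ ω, Φ (f ω) * Ψ (f ω) ∂P - (∫ ω, Φ (f ω) ∂P) * ∫ ω, Ψ (f ω) ∂P
        ∈ Set.Icc (m / ε ^ 2) (k / ε ^ 2) := by
    have h := covariance_mem_Icc_of_isSprinklableOn hf hS₁ hS₂ hL hm hk hK hΦ hΨ
    rw [covariance_eq_sub (hint hS₁ hΦ) (hint hS₂ hΨ), inv_pow, inv_mul_eq_div,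
      inv_mul_eq_div] at h
    exact h
  constructor
  · have h := (hcov hΦ₁ hΦ₂).2
    have h12 : P.real {ω | f ω ∈ A₁ ∩ A₂}
        ≤ ∫ ω, sprinkle ε A₁ (f ω) * sprinkle ε A₂ (f ω) ∂P :=
      measureReal_le_integral_of_one_le ((hint hS₁ hΦ₁).integrable_mul (hint hS₂ hΦ₂))
        (fun ω => mul_nonneg (hΦ₁.nonneg _) (hΦ₂.nonneg _))
        fun ω hω => by rw [sprinkle_eq_one hω.1, sprinkle_eq_one hω.2, one_mul]
    have h1 : ∫ ω, sprinkle ε A₁ (f ω) ∂P ≤ shiftProb P f ε A₁ :=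
      integral_le_measureReal_of_pos (hint hS₁ hΦ₁).1 (fun ω => hΦ₁.nonneg _)
        (fun ω => hΦ₁.le_one _) fun ω hω => mem_of_sprinkle_pos hi₁ hε hω
    have h2 : ∫ ω, sprinkle ε A₂ (f ω) ∂P ≤ shiftProb P f ε A₂ :=
      integral_le_measureReal_of_pos (hint hS₂ hΦ₂).1 (fun ω => hΦ₂.nonneg _)
        (fun ω => hΦ₂.le_one _) fun ω hω => mem_of_sprinkle_pos hi₂ hε hω
    have h3 := mul_le_mul h1 h2 (integral_nonneg fun ω => hΦ₂.nonneg _) measureReal_nonneg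
    linarith
  · -- The same functionals evaluated at `f - ε` vanish outside the events for `f`.
    have hΨ₁ := hΦ₁.shift (-ε)
    have hΨ₂ := hΦ₂.shift (-ε)
    have hmem {A : Set C(T, ℝ)} (hi : IsIncreasing A) {g : C(T, ℝ)}
        (hg : 0 < sprinkle ε A (g + ContinuousMap.const T (-ε))) : g ∈ A := by
      have := mem_of_sprinkle_pos hi hε hg
      convert this using 1
      ext x
      simp
    have h := (hcov hΨ₁ hΨ₂).1
    have h12 : ∫ ω, sprinkle ε A₁ (f ω + ContinuousMap.const T (-ε))
          * sprinkle ε A₂ (f ω + ContinuousMap.const T (-ε)) ∂P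
        ≤ P.real {ω | f ω ∈ A₁ ∩ A₂} :=
      integral_le_measureReal_of_pos ((hint hS₁ hΨ₁).1.mul (hint hS₂ hΨ₂).1)
        (fun ω => mul_nonneg (hΦ₁.nonneg _) (hΦ₂.nonneg _))
        (fun ω => mul_le_one₀ (hΦ₁.le_one _) (hΦ₂.nonneg _) (hΦ₂.le_one _))
        fun ω hω => ⟨hmem hi₁ (pos_of_mul_pos_left hω (hΦ₂.nonneg _)),
          hmem hi₂ (pos_of_mul_pos_right hω (hΦ₁.nonneg _))⟩
    have h1 : shiftProb P f (-ε) A₁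
        ≤ ∫ ω, sprinkle ε A₁ (f ω + ContinuousMap.const T (-ε)) ∂P :=
      measureReal_le_integral_of_one_le ((hint hS₁ hΨ₁).integrable (by norm_num))
        (fun ω => hΦ₁.nonneg _) fun ω hω => (sprinkle_eq_one hω).ge
    have h2 : shiftProb P f (-ε) A₂
        ≤ ∫ ω, sprinkle ε A₂ (f ω + ContinuousMap.const T (-ε)) ∂P :=
      measureReal_le_integral_of_one_le ((hint hS₂ hΨ₂).integrable (by norm_num))
        (fun ω => hΦ₂.nonneg _) fun ω hω => (sprinkle_eq_one hω).ge
    have h3 := mul_le_mul h1 h2 measureReal_nonneg (integral_nonneg fun ω => hΦ₁.nonneg _)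
    rw [neg_div]
    linarith

end SprinkledDecoupling

theorem mainTheorem2 :
    ∃ c : ℝ, 0 < c ∧
      ∀ (d : ℕ) (D : Set (EuclideanSpace ℝ (Fin d)))
        (Ω : Type*) [MeasurableSpace Ω] (P : Measure Ω) [IsProbabilityMeasure P]
        (f : Ω → C(D, ℝ)) (_hf : IsGaussianProcess (fun (x : D) (ω : Ω) => f ω x) P)
        (D₁ D₂ : Set D) (_hD₁ : IsCompact D₁) (_hD₂ : IsCompact D₂),
        BddAbove (Set.range fun p : D₁ × D₂ =>
          |SprinkledDecoupling.covKernel P f p.1 p.2|) ∧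
        ∀ (A₁ A₂ : Set C(D, ℝ))
          (_hA₁ : SprinkledDecoupling.IsPathEvent A₁) (_hA₂ : SprinkledDecoupling.IsPathEvent A₂)
          (_hi₁ : SprinkledDecoupling.IsIncreasing A₁) (_hi₂ : SprinkledDecoupling.IsIncreasing A₂)
          (_hs₁ : SprinkledDecoupling.IsSupportedOn A₁ D₁)
          (_hs₂ : SprinkledDecoupling.IsSupportedOn A₂ D₂)
          (ε : ℝ) (_hε : 0 < ε),
          (P.real {ω | f ω ∈ A₁ ∩ A₂}
              - SprinkledDecoupling.shiftProb P f ε A₁ * SprinkledDecoupling.shiftProb P f ε A₂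
            ≤ c * SprinkledDecoupling.kernelSupNorm (SprinkledDecoupling.covKernel P f) D₁ D₂
                / ε ^ 2) ∧
          (SprinkledDecoupling.shiftProb P f (-ε) A₁ * SprinkledDecoupling.shiftProb P f (-ε) A₂
              - P.real {ω | f ω ∈ A₁ ∩ A₂}
            ≤ c * SprinkledDecoupling.kernelSupNorm (SprinkledDecoupling.covKernel P f) D₁ D₂
                / ε ^ 2) ∧
          ((∀ x ∈ D₁, ∀ y ∈ D₂, 0 ≤ SprinkledDecoupling.covKernel P f x y) →
            (P.real {ω | f ω ∈ A₁ ∩ A₂}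
                - SprinkledDecoupling.shiftProb P f ε A₁ * SprinkledDecoupling.shiftProb P f ε A₂
              ≤ SprinkledDecoupling.kernelSupNorm (SprinkledDecoupling.covKernel P f) D₁ D₂
                  / ε ^ 2) ∧
            (SprinkledDecoupling.shiftProb P f (-ε) A₁ * SprinkledDecoupling.shiftProb P f (-ε) A₂
                - P.real {ω | f ω ∈ A₁ ∩ A₂} ≤ 0)) := by
  refine ⟨1, one_pos, ?_⟩
  intro d D Ω _ P _ f hf D₁ D₂ hD₁ hD₂
  have hbdd := SprinkledDecoupling.bddAbove_abs_covKernel hf hD₁ hD₂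
  refine ⟨hbdd, ?_⟩
  intro A₁ A₂ _ _ hi₁ hi₂ hs₁ hs₂ ε hε
  set κ := SprinkledDecoupling.kernelSupNorm (SprinkledDecoupling.covKernel P f) D₁ D₂ with hκ
  have hκ0 : 0 ≤ κ := Real.iSup_nonneg fun _ => abs_nonneg _
  have hK (x : D) (hx : x ∈ D₁) (y : D) (hy : y ∈ D₂) :
      |SprinkledDecoupling.covKernel P f x y| ≤ κ :=
    le_ciSup hbdd (⟨⟨x, hx⟩, ⟨y, hy⟩⟩ : D₁ × D₂)
  have h := SprinkledDecoupling.sprinkled_decoupling hf hD₁ hD₂ (neg_nonpos.2 hκ0) hκ0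
    (fun x hx y hy => abs_le.1 (hK x hx y hy)) hi₁ hi₂ hs₁ hs₂ hε
  rw [neg_neg] at h
  rw [one_mul]
  refine ⟨h.1, h.2, fun hpos => ?_⟩
  have h' := SprinkledDecoupling.sprinkled_decoupling hf hD₁ hD₂ le_rfl hκ0
    (fun x hx y hy => ⟨hpos x hx y hy, (abs_le.1 (hK x hx y hy)).2⟩) hi₁ hi₂ hs₁ hs₂ hε
  rw [neg_zero, zero_div] at h'
  exact h'
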